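/- Let $M$ be a finite-dimensional smooth ($C^\infty$) manifold without boundary, Hausdorff, connected and paracompact. A \emph{metric} on $M$ means a smooth field $g$ of nondegenerate symmetric bilinear forms on the tangent spaces (positive definiteness is not required). For a smooth torsion-free Koszul connection $\nabla$ on $M$ and a metric $g$, let $\nabla^g$ be the Koszul connection defined by $$g(\nabla^g_XY,Z)=X\,g(Y,Z)-g(Y,\nabla_XZ)$$ for all vector fields $X,Y,Z$, and let $J_{\nabla\nabla^g}$ be the space of global smooth sections $\phi$ of $\mathrm{Hom}(TM,TM)$ that solve the gauge equation $\nabla^g\circ\phi=\phi\circ\nabla$, i.e. $\nabla^g_X(\phi(Y))=\phi(\nabla_XY)$ for all vector fields $X,Y$. For $\phi\in J_{\nabla\nabla^g}$ let $\Phi^*$ be the section of $\mathrm{Hom}(TM,TM)$ with $$g(\Phi^*(X),Y)=\tfrac12\left[g(\phi(X),Y)-g(X,\phi(Y))\right].$$ The form $g(\Phi^*\cdot,\cdot)$ is $\nabla$-parallel and $M$ is connected, so the rank of $\Phi^*(x):T_xM\to T_xM$ does not depend on $x\in M$; it is denoted by $\mathrm{rank}(\Phi^*)$. Put $$s^{*b}(\nabla,g)=\min_{\phi\in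 J_{\nabla\nabla^g}}\left[\dim M-\mathrm{rank}(\Phi^*)\right],\qquad s^{*b}(M)=\min_{(\nabla,g)}s^{*b}(\nabla,g),$$ where $(\nabla,g)$ runs over all pairs of a smooth torsion-free Koszul connection and a metric on $M$. Then the following assertions are equivalent: (1) $s^{*b}(M)=0$; (2) $M$ admits a symplectic structure, i.e. a smooth closed nondegenerate differential $2$-form. -/

import Mathlib

open Bundle FiberBundle
open scoped Manifold ContDiff

noncomputable section

/-! ## Metrics, symplectic forms and gauge transformations

`M` is a smooth manifold without boundary, modelled on a finite-dimensional real vector space `E`.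
All tensor fields are smooth sections of the corresponding bundles. -/

/-- A Riemannian metric in the general (possibly indefinite) sense: a smooth field of
nondegenerate symmetric bilinear forms on the tangent spaces. -/
structure PseudoRiemannianMetric (E : Type*) [NormedAddCommGroup E] [NormedSpace ℝ E]
    (M : Type*) [TopologicalSpace M] [ChartedSpace E M] [IsManifold 𝓘(ℝ, E) ∞ M] where
  /-- The bilinear form on each tangent space. -/
  val (x : M) : TangentSpace 𝓘(ℝ, E) x →L[ℝ] TangentSpace 𝓘(ℝ, E) x →L[ℝ] ℝ
  symm (x : M) (u v : TangentSpace 𝓘(ℝ, E) x) : val x u v = val x v u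
  nondegenerate (x : M) (u : TangentSpace 𝓘(ℝ, E) x) (hu : ∀ v, val x u v = 0) : u = 0
  contMDiff : ContMDiff 𝓘(ℝ, E) (𝓘(ℝ, E).prod 𝓘(ℝ, E →L[ℝ] E →L[ℝ] ℝ)) ∞
    (fun x ↦ TotalSpace.mk' (E →L[ℝ] E →L[ℝ] ℝ)
      (E := fun y : M ↦ TangentSpace 𝓘(ℝ, E) y →L[ℝ] TangentSpace 𝓘(ℝ, E) y →L[ℝ] ℝ) x (val x))

/-- A symplectic structure: a smooth nondegenerate closed differential 2-form `ω`. Closedness is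
`dω = 0`, with the exterior derivative evaluated on smooth vector fields by the invariant
formula. -/
structure SymplecticStructure (E : Type*) [NormedAddCommGroup E] [NormedSpace ℝ E]
    (M : Type*) [TopologicalSpace M] [ChartedSpace E M] [IsManifold 𝓘(ℝ, E) ∞ M] where
  /-- The bilinear form on each tangent space. -/
  val (x : M) : TangentSpace 𝓘(ℝ, E) x →L[ℝ] TangentSpace 𝓘(ℝ, E) x →L[ℝ] ℝ
  alt (x : M) (u : TangentSpace 𝓘(ℝ, E) x) : val x u u = 0
  nondegenerate (x : M) (u : TangentSpace 𝓘(ℝ, E) x) (hu : ∀ v, val x u v = 0) : u = 0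
  contMDiff : ContMDiff 𝓘(ℝ, E) (𝓘(ℝ, E).prod 𝓘(ℝ, E →L[ℝ] E →L[ℝ] ℝ)) ∞
    (fun x ↦ TotalSpace.mk' (E →L[ℝ] E →L[ℝ] ℝ)
      (E := fun y : M ↦ TangentSpace 𝓘(ℝ, E) y →L[ℝ] TangentSpace 𝓘(ℝ, E) y →L[ℝ] ℝ) x (val x))
  closed (X Y Z : Π x : M, TangentSpace 𝓘(ℝ, E) x)
    (hX : ContMDiff 𝓘(ℝ, E) (𝓘(ℝ, E).prod 𝓘(ℝ, E)) ∞ (T% X))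
    (hY : ContMDiff 𝓘(ℝ, E) (𝓘(ℝ, E).prod 𝓘(ℝ, E)) ∞ (T% Y))
    (hZ : ContMDiff 𝓘(ℝ, E) (𝓘(ℝ, E).prod 𝓘(ℝ, E)) ∞ (T% Z)) (x : M) :
    d% (fun y ↦ val y (Y y) (Z y)) x (X x) - d% (fun y ↦ val y (X y) (Z y)) x (Y x)
      + d% (fun y ↦ val y (X y) (Y y)) x (Z x)
      - val x (VectorField.mlieBracket 𝓘(ℝ, E) X Y x) (Z x)
      + val x (VectorField.mlieBracket 𝓘(ℝ, E) X Z x) (Y x)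
      - val x (VectorField.mlieBracket 𝓘(ℝ, E) Y Z x) (X x) = 0

/-- An infinitesimal gauge transformation: a smooth section of `Hom(TM, TM)`. -/
structure InfinitesimalGauge (E : Type*) [NormedAddCommGroup E] [NormedSpace ℝ E]
    (M : Type*) [TopologicalSpace M] [ChartedSpace E M] [IsManifold 𝓘(ℝ, E) ∞ M] where
  /-- The endomorphism of each tangent space. -/
  val (x : M) : TangentSpace 𝓘(ℝ, E) x →L[ℝ] TangentSpace 𝓘(ℝ, E) x
  contMDiff : ContMDiff 𝓘(ℝ, E) (𝓘(ℝ, E).prod 𝓘(ℝ, E →L[ℝ] E)) ∞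
    (fun x ↦ TotalSpace.mk' (E →L[ℝ] E)
      (E := fun y : M ↦ TangentSpace 𝓘(ℝ, E) y →L[ℝ] TangentSpace 𝓘(ℝ, E) y) x (val x))

/-- A smooth torsion-free Koszul connection on `M`. In `conn Y x u` the vector field `Y` is
differentiated at `x` in the direction `u`; on paper this is `∇_u Y`. -/
structure TorsionFreeConnection (E : Type*) [NormedAddCommGroup E] [NormedSpace ℝ E]
    [FiniteDimensional ℝ E]
    (M : Type*) [TopologicalSpace M] [ChartedSpace E M] [IsManifold 𝓘(ℝ, E) ∞ M] where
  /-- The covariant derivative on the tangent bundle. -/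
  conn : CovariantDerivative 𝓘(ℝ, E) E (TangentSpace 𝓘(ℝ, E) : M → Type _)
  smooth : CovariantDerivative.ContMDiffCovariantDerivative conn ∞
  torsion_eq_zero : conn.torsion = 0

/-! ## The dual connection of Amari -/

section

variable {E : Type*} [NormedAddCommGroup E] [NormedSpace ℝ E]
  {M : Type*} [TopologicalSpace M] [ChartedSpace E M] [IsManifold 𝓘(ℝ, E) ∞ M]

instance instT2SpaceTangent (x : M) : T2Space (TangentSpace 𝓘(ℝ, E) x) :=
  inferInstanceAs (T2Space E)

namespace PseudoRiemannianMetric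

variable (g : PseudoRiemannianMetric E M)

/-- The metric at `x` as an algebraic bilinear form. -/
def form (x : M) : LinearMap.BilinForm ℝ (TangentSpace 𝓘(ℝ, E) x) :=
  (ContinuousLinearMap.coeLM ℝ).comp (g.val x : _ →ₗ[ℝ] _)

theorem form_apply (x : M) (u v : TangentSpace 𝓘(ℝ, E) x) : g.form x u v = g.val x u v := rfl

theorem form_nondegenerate (x : M) : (g.form x).Nondegenerate :=
  ⟨fun u hu ↦ g.nondegenerate x u hu,
    fun u hu ↦ g.nondegenerate x u fun v ↦ (g.symm x u v).trans (hu v)⟩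

theorem mdifferentiableAt_apply {Y Z : Π x : M, TangentSpace 𝓘(ℝ, E) x} {x : M}
    (hY : MDiffAt (T% Y) x) (hZ : MDiffAt (T% Z) x) :
    MDiffAt (fun y ↦ g.val y (Y y) (Z y)) x := by
  have : MDifferentiableAt 𝓘(ℝ, E) (𝓘(ℝ, E).prod 𝓘(ℝ))
      (fun m ↦ TotalSpace.mk' ℝ (E := Bundle.Trivial M ℝ) m (g.val m (Y m) (Z m))) x := by
    apply MDifferentiableAt.clm_bundle_apply₂ (F₁ := E) (F₂ := E)
    · exact g.contMDiff.mdifferentiableAt (by simp)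
    · exact hY
    · exact hZ
  simp only [mdifferentiableAt_totalSpace] at this
  exact this.2

/-- For a connection `∇` and vector fields `Y`, `Z`, this is the linear form
`u ↦ u g(Y, Z) - g(Y, ∇_u Z)` on the tangent space at `x`. -/
def dualPairing (D : CovariantDerivative 𝓘(ℝ, E) E (TangentSpace 𝓘(ℝ, E) : M → Type _))
    (Y Z : Π x : M, TangentSpace 𝓘(ℝ, E) x) (x : M) : TangentSpace 𝓘(ℝ, E) x →L[ℝ] ℝ :=
  d% (fun y ↦ g.val y (Y y) (Z y)) x - (g.val x (Y x)).comp (D Z x)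

theorem dualPairing_tensorial
    (D : CovariantDerivative 𝓘(ℝ, E) E (TangentSpace 𝓘(ℝ, E) : M → Type _))
    {Y : Π x : M, TangentSpace 𝓘(ℝ, E) x} {x : M} (hY : MDiffAt (T% Y) x) :
    TensorialAt 𝓘(ℝ, E) E (fun Z ↦ g.dualPairing D Y Z x) x where
  smul {f Z} hf hZ := by
    have h := mvfderiv_fun_mul hf (g.mdifferentiableAt_apply hY hZ)
    ext u
    simp [dualPairing, D.isCovariantDerivativeOn.leibniz hZ hf, h]
    ring
  add {Z Z'} hZ hZ' := by
    have h := mvfderiv_fun_add (g.mdifferentiableAt_apply hY hZ) (g.mdifferentiableAt_apply hY hZ')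
    ext u
    simp [dualPairing, D.isCovariantDerivativeOn.add hZ hZ', h]
    abel

theorem ext_val {x : M} {u v : TangentSpace 𝓘(ℝ, E) x}
    (h : ∀ Z : Π x : M, TangentSpace 𝓘(ℝ, E) x, MDiffAt (T% Z) x →
      g.val x u (Z x) = g.val x v (Z x)) : u = v := by
  refine sub_eq_zero.1 (g.nondegenerate x _ fun z ↦ ?_)
  have := h (FiberBundle.extend E z) (mdifferentiableAt_extend ..)
  simp only [FiberBundle.extend_apply_self] at this
  simp [this]

/-- The form `ω(g, φ)(u, v) = (g(φ u, v) - g(u, φ v)) / 2` on the tangent space at `x`. -/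
def skewForm (φ : InfinitesimalGauge E M) (x : M) :
    LinearMap.BilinForm ℝ (TangentSpace 𝓘(ℝ, E) x) :=
  (1 / 2 : ℝ) • ((g.form x).compLeft (φ.val x) - (g.form x).compRight (φ.val x))

theorem skewForm_apply (φ : InfinitesimalGauge E M) (x : M) (u v : TangentSpace 𝓘(ℝ, E) x) :
    g.skewForm φ x u v = (1 / 2 : ℝ) * (g.val x (φ.val x u) v - g.val x u (φ.val x v)) := rfl

end PseudoRiemannianMetric

end

section

variable {E : Type*} [NormedAddCommGroup E] [NormedSpace ℝ E] [FiniteDimensional ℝ E]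
  {M : Type*} [TopologicalSpace M] [ChartedSpace E M] [IsManifold 𝓘(ℝ, E) ∞ M]

instance instFiniteDimensionalTangent (x : M) :
    FiniteDimensional ℝ (TangentSpace 𝓘(ℝ, E) x) :=
  inferInstanceAs (FiniteDimensional ℝ E)

namespace PseudoRiemannianMetric

variable (g : PseudoRiemannianMetric E M)

/-- The vector `g`-dual to a linear form on the tangent space at `x`. -/
def sharp (x : M) : Module.Dual ℝ (TangentSpace 𝓘(ℝ, E) x) ≃ₗ[ℝ] TangentSpace 𝓘(ℝ, E) x :=
  ((g.form x).toDual (g.form_nondegenerate x)).symm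

theorem val_sharp (x : M) (α : Module.Dual ℝ (TangentSpace 𝓘(ℝ, E) x))
    (v : TangentSpace 𝓘(ℝ, E) x) : g.val x (g.sharp x α) v = α v :=
  LinearMap.BilinForm.apply_toDual_symm_apply (B := g.form x) (hB := g.form_nondegenerate x) α v

open Classical in
/-- The bilinear form `(z, u) ↦ u g(Y, Z) - g(Y, ∇_u Z)` on the tangent space at `x`, where `Z` is
any vector field with value `z` at `x` (and `Y` is differentiable at `x`). -/
def dualForm (D : CovariantDerivative 𝓘(ℝ, E) E (TangentSpace 𝓘(ℝ, E) : M → Type _))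
    (Y : Π x : M, TangentSpace 𝓘(ℝ, E) x) (x : M) :
    TangentSpace 𝓘(ℝ, E) x →L[ℝ] TangentSpace 𝓘(ℝ, E) x →L[ℝ] ℝ :=
  if hY : MDiffAt (T% Y) x then
    TensorialAt.mkHom (fun Z ↦ g.dualPairing D Y Z x) x (g.dualPairing_tensorial D hY)
  else 0

theorem dualForm_apply (D : CovariantDerivative 𝓘(ℝ, E) E (TangentSpace 𝓘(ℝ, E) : M → Type _))
    {Y Z : Π x : M, TangentSpace 𝓘(ℝ, E) x} {x : M}
    (hY : MDiffAt (T% Y) x) (hZ : MDiffAt (T% Z) x) :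
    g.dualForm D Y x (Z x) = g.dualPairing D Y Z x := by
  rw [dualForm, dif_pos hY, TensorialAt.mkHom_apply _ hZ]

/-- The underlying operator of the connection `∇^g`: the vector `∇^g_u Y` is the one whose
`g`-product with every `z` is `u g(Y, Z) - g(Y, ∇_u Z)`. -/
def dualFun (D : CovariantDerivative 𝓘(ℝ, E) E (TangentSpace 𝓘(ℝ, E) : M → Type _))
    (Y : Π x : M, TangentSpace 𝓘(ℝ, E) x) (x : M) :
    TangentSpace 𝓘(ℝ, E) x →L[ℝ] TangentSpace 𝓘(ℝ, E) x :=
  LinearMap.toContinuousLinearMap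
    ((g.sharp x).toLinearMap.comp
      ((ContinuousLinearMap.coeLM ℝ).comp (g.dualForm D Y x : _ →ₗ[ℝ] _)).flip)

theorem val_dualFun (D : CovariantDerivative 𝓘(ℝ, E) E (TangentSpace 𝓘(ℝ, E) : M → Type _))
    {Y Z : Π x : M, TangentSpace 𝓘(ℝ, E) x} {x : M}
    (hY : MDiffAt (T% Y) x) (hZ : MDiffAt (T% Z) x) (u : TangentSpace 𝓘(ℝ, E) x) :
    g.val x (g.dualFun D Y x u) (Z x) =
      d% (fun y ↦ g.val y (Y y) (Z y)) x u - g.val x (Y x) (D Z x u) := by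
  have h : g.val x (g.dualFun D Y x u) (Z x) = g.dualForm D Y x (Z x) u := g.val_sharp x _ _
  rw [h, g.dualForm_apply D hY hZ]
  rfl

/-- The connection `∇^g` dual to `∇` with respect to `g`, characterised by
`g(∇^g_X Y, Z) = X g(Y, Z) - g(Y, ∇_X Z)`, see `val_dualFun`. -/
def dualConnection (D : CovariantDerivative 𝓘(ℝ, E) E (TangentSpace 𝓘(ℝ, E) : M → Type _)) :
    CovariantDerivative 𝓘(ℝ, E) E (TangentSpace 𝓘(ℝ, E) : M → Type _) where
  toFun := g.dualFun D
  isCovariantDerivativeOnUniv :=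
    { add := fun {Y Y' x} hY hY' _ ↦ by
        ext1 u
        refine g.ext_val fun Z hZ ↦ ?_
        have h := mvfderiv_fun_add (g.mdifferentiableAt_apply hY hZ)
          (g.mdifferentiableAt_apply hY' hZ)
        rw [g.val_dualFun D (mdifferentiableAt_add_section hY hY') hZ]
        simp [g.val_dualFun D hY hZ, g.val_dualFun D hY' hZ, h]
        abel
      leibniz := fun {Y f x} hY hf _ ↦ by
        ext1 u
        refine g.ext_val fun Z hZ ↦ ?_
        have h := mvfderiv_fun_mul hf (g.mdifferentiableAt_apply hY hZ)
        rw [g.val_dualFun D (hf.smul_section hY) hZ]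
        simp [g.val_dualFun D hY hZ, h]
        ring }

theorem dualConnection_apply
    (D : CovariantDerivative 𝓘(ℝ, E) E (TangentSpace 𝓘(ℝ, E) : M → Type _))
    {Y Z : Π x : M, TangentSpace 𝓘(ℝ, E) x} {x : M}
    (hY : MDiffAt (T% Y) x) (hZ : MDiffAt (T% Z) x) (u : TangentSpace 𝓘(ℝ, E) x) :
    g.val x (g.dualConnection D Y x u) (Z x) =
      d% (fun y ↦ g.val y (Y y) (Z y)) x u - g.val x (Y x) (D Z x u) :=
  g.val_dualFun D hY hZ u

/-! ## The gauge equation and the symplectic gap -/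

/-- `J_{∇∇^g}`: the global solutions `φ` of the gauge equation `∇^g ∘ φ = φ ∘ ∇`, that is
`∇^g_X (φ Y) = φ (∇_X Y)` for all vector fields `X` and `Y`. -/
def gaugeSolutions (D : TorsionFreeConnection E M) : Set (InfinitesimalGauge E M) :=
  {φ | ∀ X Y : Π x : M, TangentSpace 𝓘(ℝ, E) x,
    ContMDiff 𝓘(ℝ, E) (𝓘(ℝ, E).prod 𝓘(ℝ, E)) ∞ (T% X) →
    ContMDiff 𝓘(ℝ, E) (𝓘(ℝ, E).prod 𝓘(ℝ, E)) ∞ (T% Y) →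
    ∀ x, g.dualConnection D.conn (fun y ↦ φ.val y (Y y)) x (X x) = φ.val x (D.conn Y x (X x))}

/-- The skew part `Φ*` of `φ`: the endomorphism with `g(Φ* u, v) = ω(g, φ)(u, v)`. -/
def skewPart (φ : InfinitesimalGauge E M) (x : M) :
    TangentSpace 𝓘(ℝ, E) x →ₗ[ℝ] TangentSpace 𝓘(ℝ, E) x :=
  (g.sharp x).toLinearMap.comp (g.skewForm φ x)

theorem val_skewPart (φ : InfinitesimalGauge E M) (x : M) (u v : TangentSpace 𝓘(ℝ, E) x) :
    g.val x (g.skewPart φ x u) v =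
      (1 / 2 : ℝ) * (g.val x (φ.val x u) v - g.val x u (φ.val x v)) :=
  g.val_sharp x _ _

/-- `dim M - rank Φ*(x)`, a natural number because the rank is at most `dim M`. -/
def corankAt (φ : InfinitesimalGauge E M) (x : M) : ℕ :=
  Module.finrank ℝ E - Module.finrank ℝ (LinearMap.range (g.skewPart φ x))

/-- The number `s^{*b}(∇, g)`: the minimum of `dim M - rank Φ*` over the solutions `φ` of the gauge
equation. The rank of the parallel field `Φ*` does not depend on the point when `M` is connected;
the minimum here is taken over all solutions and all points. -/
def gap (D : TorsionFreeConnection E M) : ℕ∞ :=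
  ⨅ φ ∈ g.gaugeSolutions D, ⨅ x : M, (g.corankAt φ x : ℕ∞)

end PseudoRiemannianMetric

end

/-- The symplectic gap `s^{*b}(M)`: the minimum of `s^{*b}(∇, g)` over all torsion-free connections
`∇` and all metrics `g` on `M`. Infima in `ℕ∞` of nonempty families of natural numbers are minima,
and the infimum of the empty family would be `⊤`. -/
def symplecticGap (E : Type*) [NormedAddCommGroup E] [NormedSpace ℝ E] [FiniteDimensional ℝ E]
    (M : Type*) [TopologicalSpace M] [ChartedSpace E M] [IsManifold 𝓘(ℝ, E) ∞ M] : ℕ∞ :=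
  ⨅ (D : TorsionFreeConnection E M) (g : PseudoRiemannianMetric E M), g.gap D

end

/-! If `φ` solves the gauge equation, the field of forms `ω = g(Φ* ·, ·)` is parallel for `∇`. The
Gram determinant of a parallel form in a chart solves a linear homogeneous equation of first order,
so that, `M` being connected, `ω` is nondegenerate everywhere as soon as `Φ*` has corank zero at one
point. A form which is parallel for a torsion-free connection is closed.

Conversely let `ω` be symplectic. In a chart the symbols given by
`ω(Γ(e, u), f) = (u ω(e, f) + e ω(u, f)) / 3` are symmetric and, because `dω = 0`, they define a
connection with `∇ω = 0`. Vanishing torsion and `∇ω = 0` are affine conditions on `∇`, so a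
partition of unity gives such a connection on all of `M`. For any Riemannian metric `g`, the field
`φ` with `g(φ ·, ·) = ω` then solves the gauge equation, and `Φ* = φ` is invertible. -/

noncomputable section

open Set Topology

section

/-! ## σ-compactness of connected paracompact spaces -/

variable {X ι : Type*} [TopologicalSpace X]

theorem isClopen_of_open_cover {V : ι → Set X} {S : Set X} (hVo : ∀ i, IsOpen (V i))
    (hV : ⋃ i, V i = univ) (hS : ∀ i, (V i ∩ S).Nonempty → V i ⊆ S) : IsClopen S := by
  have hcover (y : X) : ∃ i, y ∈ V i := mem_iUnion.1 (hV.ge (mem_univ y))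
  refine ⟨isClosed_of_closure_subset fun y hy ↦ ?_, isOpen_iff_mem_nhds.2 fun y hy ↦ ?_⟩ <;>
    obtain ⟨i, hi⟩ := hcover y
  · exact hS i (mem_closure_iff.1 hy _ (hVo i) hi) hi
  · exact Filter.mem_of_superset ((hVo i).mem_nhds hi) (hS i ⟨y, hi, hy⟩)

theorem exists_open_cover_locallyFinite_isCompact_closure (X : Type*) [TopologicalSpace X]
    [T2Space X] [LocallyCompactSpace X] [ParacompactSpace X] :
    ∃ V : X → Set X, (∀ i, IsOpen (V i)) ∧ ⋃ i, V i = univ ∧ LocallyFinite V ∧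
      ∀ i, IsCompact (closure (V i)) := by
  choose K hKc hK using fun x : X ↦ exists_compact_mem_nhds x
  obtain ⟨V, hVo, hVU, hVf, hVK⟩ := precise_refinement (fun x ↦ interior (K x))
    (fun x ↦ isOpen_interior)
    (eq_univ_of_forall fun x ↦ mem_iUnion.2 ⟨x, mem_interior_iff_mem_nhds.2 (hK x)⟩)
  exact ⟨V, hVo, hVU, hVf, fun i ↦ (hKc i).of_isClosed_subset isClosed_closure
    (closure_minimal ((hVK i).trans interior_subset) (hKc i).isClosed)⟩

/-- Starting from a point, repeatedly add the closures of all members of the cover that meet the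
compact set obtained so far; by local finiteness only finitely many are added at each stage. -/
theorem sigmaCompactSpace_of_connected_paracompact (X : Type*) [TopologicalSpace X] [T2Space X]
    [LocallyCompactSpace X] [ParacompactSpace X] [ConnectedSpace X] : SigmaCompactSpace X := by
  obtain ⟨V, hVo, hVU, hVf, hVc⟩ := exists_open_cover_locallyFinite_isCompact_closure X
  obtain ⟨x₀⟩ : Nonempty X := inferInstance
  let next (A : Set X) : Set X := ⋃ i ∈ {i | (V i ∩ A).Nonempty}, closure (V i)
  let A (n : ℕ) : Set X := next^[n] {x₀}
  have hA_succ (n : ℕ) : A (n + 1) = next (A n) := Function.iterate_succ_apply' ..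
  have hA_compact (n : ℕ) : IsCompact (A n) := by
    induction n with
    | zero => exact isCompact_singleton
    | succ n ih =>
      rw [hA_succ]
      exact (hVf.finite_nonempty_inter_compact ih).isCompact_biUnion fun i _ ↦ hVc i
  have hV_subset {i : X} {n : ℕ} (h : (V i ∩ A n).Nonempty) : V i ⊆ A (n + 1) := by
    rw [hA_succ]
    exact subset_closure.trans (subset_biUnion_of_mem (u := fun i ↦ closure (V i)) h)
  have hclopen : IsClopen (⋃ n, A n) := isClopen_of_open_cover hVo hVU fun i hi ↦ by
    rw [inter_iUnion, nonempty_iUnion] at hi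
    obtain ⟨n, hn⟩ := hi
    exact (hV_subset hn).trans (subset_iUnion A (n + 1))
  exact SigmaCompactSpace_iff_exists_compact_covering.2
    ⟨A, hA_compact, hclopen.eq_univ ⟨x₀, mem_iUnion.2 ⟨0, rfl⟩⟩⟩

end

section

/-! ## Fields on a manifold in coordinates -/

variable {E : Type*} [NormedAddCommGroup E] [NormedSpace ℝ E]
  {F : Type*} [NormedAddCommGroup F] [NormedSpace ℝ F]
  {M : Type*} [TopologicalSpace M] [ChartedSpace E M]

theorem mvfderiv_congr_of_eventuallyEq {f g : M → F} {y : M} (h : f =ᶠ[𝓝 y] g) :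
    mvfderiv 𝓘(ℝ, E) f y = mvfderiv 𝓘(ℝ, E) g y := by
  unfold mvfderiv
  rw [h.mfderiv_eq]
  rfl

theorem mvfderiv_clm_apply_const {V : Type*} [NormedAddCommGroup V] [NormedSpace ℝ V]
    {f : M → V →L[ℝ] F} {y : M} (hf : MDiffAt f y) (v : V) (u : TangentSpace 𝓘(ℝ, E) y) :
    mvfderiv 𝓘(ℝ, E) (fun z ↦ f z v) y u = mvfderiv 𝓘(ℝ, E) f y u v :=
  congrArg (fun A : TangentSpace 𝓘(ℝ, E) y →L[ℝ] F ↦ A u)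
    ((ContinuousLinearMap.apply ℝ F v).hasMFDerivAt.comp y hf.hasMFDerivAt).mfderiv

variable [IsManifold 𝓘(ℝ, E) ∞ M]

variable (E M) in
/-- Vector fields on `M`, without any smoothness assumption. -/
abbrev TangentField : Type _ :=
  Π x : M, TangentSpace 𝓘(ℝ, E) x

variable (E M) in
/-- Fields of bilinear forms on the tangent spaces of `M`, without any smoothness assumption. -/
abbrev BilinField : Type _ :=
  Π x : M, TangentSpace 𝓘(ℝ, E) x →L[ℝ] TangentSpace 𝓘(ℝ, E) x →L[ℝ] ℝ

variable (E M) in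
/-- Fields of endomorphisms of the tangent spaces of `M`, without any smoothness assumption. -/
abbrev EndoField : Type _ :=
  Π x : M, TangentSpace 𝓘(ℝ, E) x →L[ℝ] TangentSpace 𝓘(ℝ, E) x

/-- A field of bilinear forms is smooth on `s`, as a section of the bundle of bilinear forms. -/
abbrev SmoothBilinOn (q : BilinField E M) (s : Set M) : Prop :=
  ContMDiffOn 𝓘(ℝ, E) (𝓘(ℝ, E).prod 𝓘(ℝ, E →L[ℝ] E →L[ℝ] ℝ)) ∞
    (fun x ↦ TotalSpace.mk' (E →L[ℝ] E →L[ℝ] ℝ)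
      (E := fun y : M ↦ TangentSpace 𝓘(ℝ, E) y →L[ℝ] TangentSpace 𝓘(ℝ, E) y →L[ℝ] ℝ) x (q x)) s

/-- A field of endomorphisms is smooth on `s`, as a section of `Hom(TM, TM)`. -/
abbrev SmoothEndoOn (a : EndoField E M) (s : Set M) : Prop :=
  ContMDiffOn 𝓘(ℝ, E) (𝓘(ℝ, E).prod 𝓘(ℝ, E →L[ℝ] E)) ∞
    (fun x ↦ TotalSpace.mk' (E →L[ℝ] E)
      (E := fun y : M ↦ TangentSpace 𝓘(ℝ, E) y →L[ℝ] TangentSpace 𝓘(ℝ, E) y) x (a x)) s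

/-- The differential at `y` of the inverse of the chart at `c`: for fixed `e`, the vector field
`y ↦ coordFrame c y e` has constant coordinates `e` in this chart. -/
def coordFrame (c y : M) : E →L[ℝ] TangentSpace 𝓘(ℝ, E) y :=
  (trivializationAt E (TangentSpace 𝓘(ℝ, E)) c).symmL ℝ y

/-- The differential at `y` of the chart at `c`. -/
def coordMap (c y : M) : TangentSpace 𝓘(ℝ, E) y →L[ℝ] E :=
  (trivializationAt E (TangentSpace 𝓘(ℝ, E)) c).continuousLinearMapAt ℝ y

/-- A field of bilinear forms read in the chart at `c`. -/
def coordBilin (c : M) (q : BilinField E M) (y : M) : E →L[ℝ] E →L[ℝ] ℝ :=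
  ContinuousLinearMap.precomp ℝ (coordFrame c y) ∘L q y ∘L coordFrame c y

/-- A field of endomorphisms read in the chart at `c`. -/
def coordEndo (c : M) (a : EndoField E M) (y : M) : E →L[ℝ] E :=
  coordMap c y ∘L a y ∘L coordFrame c y

/-- The differential of a function, read in the chart at `c`. -/
def coordDeriv (c : M) (f : M → F) (y : M) : E →L[ℝ] F :=
  (mvfderiv 𝓘(ℝ, E) f y).comp (coordFrame (E := E) c y)

variable {c y : M}

theorem coordDeriv_comp {G : Type*} [NormedAddCommGroup G] [NormedSpace ℝ G] {h : F → G}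
    {f : M → F} (hh : DifferentiableAt ℝ h (f y)) (hf : MDiffAt f y) :
    coordDeriv (E := E) c (h ∘ f) y = fderiv ℝ h (f y) ∘L coordDeriv c f y :=
  congrArg (fun A : TangentSpace 𝓘(ℝ, E) y →L[ℝ] G ↦ A.comp (coordFrame (E := E) c y))
    (hh.hasFDerivAt.hasMFDerivAt.comp y hf.hasMFDerivAt).mfderiv

theorem coordFrame_coordMap (hy : y ∈ (chartAt E c).source) (v : TangentSpace 𝓘(ℝ, E) y) :
    coordFrame c y (coordMap c y v) = v :=
  (trivializationAt E (TangentSpace 𝓘(ℝ, E)) c).symmL_continuousLinearMapAt hy v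

theorem coordMap_coordFrame (hy : y ∈ (chartAt E c).source) (e : E) :
    coordMap c y (coordFrame c y e) = e :=
  (trivializationAt E (TangentSpace 𝓘(ℝ, E)) c).continuousLinearMapAt_symmL hy e

theorem coordBilin_apply (q : BilinField E M) (e f : E) :
    coordBilin c q y e f = q y (coordFrame c y e) (coordFrame c y f) := rfl

theorem coordFrame_coordEndo (hy : y ∈ (chartAt E c).source) (a : EndoField E M) (e : E) :
    coordFrame c y (coordEndo c a y e) = a y (coordFrame c y e) :=
  coordFrame_coordMap hy _

theorem contMDiffOn_section_iff_coordMap {X : TangentField E M} :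
    CMDiff[(chartAt E c).source] ∞ (T% X) ↔
      CMDiff[(chartAt E c).source] ∞ (fun y ↦ coordMap c y (X y) : M → E) := by
  let t := trivializationAt E (TangentSpace 𝓘(ℝ, E)) c
  exact (t.contMDiffOn_section_baseSet_iff).trans
    (contMDiffOn_congr fun y hy ↦ (t.continuousLinearMapAt_apply_of_mem (R := ℝ) hy _).symm)

theorem mdifferentiableAt_coordMap {X : TangentField E M}
    (hy : y ∈ (chartAt E c).source) (hX : MDiffAt (T% X) y) :
    MDiffAt (fun z ↦ coordMap c z (X z) : M → E) y := by
  let t := trivializationAt E (TangentSpace 𝓘(ℝ, E)) c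
  refine ((t.mdifferentiableAt_section_iff 𝓘(ℝ, E) X hy).1 hX).congr_of_eventuallyEq ?_
  filter_upwards [(chartAt E c).open_source.mem_nhds hy] with z hz
  exact t.continuousLinearMapAt_apply_of_mem (R := ℝ) hz _

set_option synthInstance.maxHeartbeats 400000 in
-- Instances on iterated spaces of continuous linear maps between tangent spaces are expensive.
theorem smoothBilinOn_iff_coordBilin {q : BilinField E M} :
    SmoothBilinOn q (chartAt E c).source ↔ CMDiff[(chartAt E c).source] ∞ (coordBilin c q) := by
  let t := trivializationAt (E →L[ℝ] E →L[ℝ] ℝ)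
    (fun y : M ↦ TangentSpace 𝓘(ℝ, E) y →L[ℝ] TangentSpace 𝓘(ℝ, E) y →L[ℝ] ℝ) c
  have ht : t.baseSet = (chartAt E c).source := by
    simp [t, hom_trivializationAt_baseSet]
  rw [← ht]
  refine (Trivialization.contMDiffOn_section_baseSet_iff (n := ∞) (F := E →L[ℝ] E →L[ℝ] ℝ)
    (IB := 𝓘(ℝ, E)) t).trans (contMDiffOn_congr fun y hy ↦ ?_)
  rw [ht] at hy
  ext u v
  simp [t, ContinuousLinearMap.inCoordinates, coordBilin_apply, hy, coordFrame,
    hom_trivializationAt_apply]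

theorem smoothEndoOn_iff_coordEndo {a : EndoField E M} :
    SmoothEndoOn a (chartAt E c).source ↔ CMDiff[(chartAt E c).source] ∞ (coordEndo c a) := by
  let t := trivializationAt (E →L[ℝ] E)
    (fun y : M ↦ TangentSpace 𝓘(ℝ, E) y →L[ℝ] TangentSpace 𝓘(ℝ, E) y) c
  have ht : t.baseSet = (chartAt E c).source := by
    simp [t, hom_trivializationAt_baseSet]
  rw [← ht]
  refine t.contMDiffOn_section_baseSet_iff.trans (contMDiffOn_congr fun y _ ↦ ?_)
  simp only [t, hom_trivializationAt_apply]
  rfl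

omit [IsManifold 𝓘(ℝ, E) ∞ M] in
theorem contMDiff_of_contMDiffOn_chart_source {H N : Type*} [NormedAddCommGroup H]
    [NormedSpace ℝ H] {G : Type*} [TopologicalSpace G] {I : ModelWithCorners ℝ H G}
    [TopologicalSpace N] [ChartedSpace G N] {n : ℕ∞ω} {f : M → N}
    (hf : ∀ c, ContMDiffOn 𝓘(ℝ, E) I n f (chartAt E c).source) : ContMDiff 𝓘(ℝ, E) I n f :=
  fun c ↦ (hf c).contMDiffAt ((chartAt E c).open_source.mem_nhds (mem_chart_source E c))

theorem mdifferentiableAt_coordBilin {q : BilinField E M}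
    (hq : SmoothBilinOn q (chartAt E c).source) (hy : y ∈ (chartAt E c).source) :
    MDiffAt (coordBilin c q) y :=
  ((smoothBilinOn_iff_coordBilin.1 hq).contMDiffAt
    ((chartAt E c).open_source.mem_nhds hy)).mdifferentiableAt (by simp)

theorem coordDeriv_coordBilin_apply {q : BilinField E M}
    (hq : SmoothBilinOn q (chartAt E c).source) (hy : y ∈ (chartAt E c).source) (u e f : E) :
    coordDeriv c (coordBilin c q) y u e f =
      d% (fun z ↦ q z (coordFrame c z e) (coordFrame c z f)) y (coordFrame c y u) := by
  have hqe := mdifferentiableAt_coordBilin hq hy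
  change _ = mvfderiv 𝓘(ℝ, E) (fun z ↦ coordBilin c q z e f) y (coordFrame c y u)
  rw [mvfderiv_clm_apply_const (hqe.clm_apply mdifferentiableAt_const),
    mvfderiv_clm_apply_const hqe, coordDeriv, ContinuousLinearMap.comp_apply]

theorem coordDeriv_eq_fderiv {f : M → F} (hy : y ∈ (chartAt E c).source) (hf : MDiffAt f y) :
    coordDeriv c f y = fderiv ℝ (f ∘ (chartAt E c).symm) (chartAt E c y) := by
  have hsymm : MDiffAt (chartAt E c).symm (chartAt E c y) :=
    mdifferentiableAt_atlas_symm (chart_mem_atlas E c) ((chartAt E c).map_source hy)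
  have hcomp := mfderiv_comp_of_eq hf hsymm ((chartAt E c).left_inv hy)
  rw [mfderiv_eq_fderiv] at hcomp
  refine Eq.trans ?_ hcomp.symm
  have hframe := TangentBundle.symmL_trivializationAt (I := 𝓘(ℝ, E)) hy
  simp only [modelWithCornersSelf_coe, range_id, mfderivWithin_univ] at hframe
  have hf_eq := congrArg (fun z ↦ (show E →L[ℝ] F from mfderiv 𝓘(ℝ, E) 𝓘(ℝ, F) f z))
    ((chartAt E c).left_inv hy)
  unfold coordDeriv coordFrame
  rw [hframe]
  exact congrArg (fun L : E →L[ℝ] F ↦ L.comp (show E →L[ℝ] E from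
    mfderiv 𝓘(ℝ, E) 𝓘(ℝ, E) (chartAt E c).symm (chartAt E c y))) hf_eq.symm

theorem contMDiffOn_coordDeriv {f : M → F} (hf : CMDiff[(chartAt E c).source] ∞ f) :
    CMDiff[(chartAt E c).source] ∞ (coordDeriv (E := E) c f) := by
  have hfs : ContDiffOn ℝ ∞ (f ∘ (chartAt E c).symm) (chartAt E c).target :=
    (hf.comp contMDiffOn_chart_symm fun p hp ↦ (chartAt E c).map_target hp).contDiffOn
  have hfs' := hfs.fderiv_of_isOpen (m := ∞) (chartAt E c).open_target (by simp)
  refine (hfs'.contMDiffOn.comp contMDiffOn_chart fun y hy ↦ (chartAt E c).map_source hy).congr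
    fun y hy ↦ coordDeriv_eq_fderiv hy ?_
  exact (hf.contMDiffAt ((chartAt E c).open_source.mem_nhds hy)).mdifferentiableAt (by simp)

/-! ## Coordinate vector fields -/

theorem contMDiffOn_coordFrame (e : E) :
    CMDiff[(chartAt E c).source] ∞ (T% fun y : M ↦ coordFrame c y e) :=
  contMDiffOn_section_iff_coordMap.2
    (contMDiffOn_const.congr fun _ hy ↦ coordMap_coordFrame hy e)

theorem mdifferentiableAt_coordFrame (hy : y ∈ (chartAt E c).source) (e : E) :
    MDiffAt (T% fun y : M ↦ coordFrame c y e) y :=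
  ((contMDiffOn_coordFrame e).contMDiffAt ((chartAt E c).open_source.mem_nhds hy)).mdifferentiableAt
    (by simp)

/-- The constant vector field `e` on the vector space `E`. -/
def constField (e : E) : Π x : E, TangentSpace 𝓘(ℝ, E) x := fun _ ↦ e

theorem mdifferentiableAt_constField (e p : E) : MDiffAt (T% (constField e)) p :=
  (contMDiff_vectorSpace_iff_contDiff.2 (contDiff_const (c := e) (n := 1))).mdifferentiable
    (by simp) p

theorem mlieBracket_constField (e f : E) :
    VectorField.mlieBracket 𝓘(ℝ, E) (constField e) (constField f) = 0 := by
  rw [← VectorField.mlieBracketWithin_univ, VectorField.mlieBracketWithin_eq_lieBracketWithin]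
  ext p
  change VectorField.lieBracketWithin ℝ (fun _ : E ↦ e) (fun _ ↦ f) univ p = (0 : E)
  simp [VectorField.lieBracketWithin_eq]

theorem coordFrame_eventuallyEq_mpullback (hy : y ∈ (chartAt E c).source) (e : E) :
    (fun z : M ↦ coordFrame c z e) =ᶠ[𝓝 y]
      VectorField.mpullback 𝓘(ℝ, E) 𝓘(ℝ, E) (extChartAt 𝓘(ℝ, E) c) (constField e) := by
  filter_upwards [(chartAt E c).open_source.mem_nhds hy] with z hz
  have hinv : (mfderiv 𝓘(ℝ, E) 𝓘(ℝ, E) (extChartAt 𝓘(ℝ, E) c) z).inverse =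
      coordFrame (E := E) c z := by
    rw [← TangentBundle.continuousLinearMapAt_trivializationAt hz]
    exact ContinuousLinearMap.inverse_eq
      (ContinuousLinearMap.ext fun e ↦ coordMap_coordFrame hz e)
      (ContinuousLinearMap.ext fun v ↦ coordFrame_coordMap hz v)
  exact (DFunLike.congr_fun hinv e).symm

theorem mlieBracket_coordFrame [CompleteSpace E] (hy : y ∈ (chartAt E c).source) (e f : E) :
    VectorField.mlieBracket 𝓘(ℝ, E) (fun y : M ↦ coordFrame c y e) (fun y ↦ coordFrame c y f) y
      = 0 := by
  have hchart : CMDiffAt ∞ (extChartAt 𝓘(ℝ, E) c) y := contMDiffAt_extChartAt' hy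
  have hsmooth : minSmoothness ℝ 2 ≤ ∞ := by
    rw [minSmoothness_of_isRCLikeNormedField]
    exact WithTop.coe_le_coe.2 le_top
  have : IsManifold 𝓘(ℝ, E) (minSmoothness ℝ 2) M := .of_le hsmooth
  refine ((coordFrame_eventuallyEq_mpullback hy e).mlieBracket_vectorField_eq
    (coordFrame_eventuallyEq_mpullback hy f)).trans ?_
  refine (VectorField.mpullback_mlieBracket (mdifferentiableAt_constField e _)
    (mdifferentiableAt_constField f _) hchart hsmooth).symm.trans ?_
  rw [mlieBracket_constField, VectorField.mpullback_zero, Pi.zero_apply]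

/-! ## Globally smooth extensions -/

variable [FiniteDimensional ℝ E] [T2Space M]

theorem exists_contMDiff_eventuallyEq {X : TangentField E M} {U : Set M}
    (hU : U ∈ 𝓝 y) (hX : CMDiff[U] ∞ (T% X)) :
    ∃ X' : TangentField E M, CMDiff ∞ (T% X') ∧ ∀ᶠ z in 𝓝 y, X' z = X z := by
  obtain ⟨f, -, hfU⟩ := (SmoothBumpFunction.nhds_basis_tsupport (I := 𝓘(ℝ, E)) y).mem_iff.1
    (interior_mem_nhds.2 hU)
  refine ⟨(f : M → ℝ) • X, ContMDiffOn.smul_section_of_tsupport f.contMDiff.contMDiffOn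
    isOpen_interior hfU (hX.mono interior_subset), ?_⟩
  filter_upwards [f.eventuallyEq_one] with z hz
  simp [hz]

theorem exists_contMDiff_apply_eq (u : TangentSpace 𝓘(ℝ, E) y) :
    ∃ X : TangentField E M, CMDiff ∞ (T% X) ∧ X y = u := by
  obtain ⟨X, hX, hXy⟩ := exists_contMDiff_eventuallyEq
    ((chartAt E y).open_source.mem_nhds (mem_chart_source E y))
    (contMDiffOn_coordFrame (coordMap y y u))
  exact ⟨X, hX, hXy.self_of_nhds.trans (coordFrame_coordMap (mem_chart_source E y) u)⟩

end

section

/-! ## The derivative of the determinant -/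

variable {ι : Type*} [Fintype ι] [DecidableEq ι]

/-- Jacobi's formula, written on functions `ι → ι → ℝ` because matrices carry no global norm. -/
theorem hasFDerivAt_det (A : ι → ι → ℝ) :
    HasFDerivAt (fun B : ι → ι → ℝ ↦ (Matrix.of B).det)
      (∑ i, ∑ k, (Matrix.of A).adjugate i k •
        ContinuousLinearMap.proj (R := ℝ) (φ := fun _ : ι ↦ ℝ) i ∘L
          ContinuousLinearMap.proj (φ := fun _ : ι ↦ ι → ℝ) k) A := by
  simp only [Matrix.det_apply', Matrix.of_apply]
  refine (HasFDerivAt.fun_sum fun σ _ ↦ (HasFDerivAt.finsetProd fun i _ ↦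
    (ContinuousLinearMap.proj (R := ℝ) (φ := fun _ : ι ↦ ℝ) i ∘L
      ContinuousLinearMap.proj (φ := fun _ : ι ↦ ι → ℝ) (σ i)).hasFDerivAt).const_mul
        ((Equiv.Perm.sign σ : ℤ) : ℝ)).congr_fderiv ?_
  ext B
  have hcramer (i : ι) : ∑ k, (Matrix.of A).adjugate i k * B k i =
      ((Matrix.of A).updateCol i fun k ↦ B k i).det := by
    rw [← Matrix.cramer_apply, Matrix.cramer_eq_adjugate_mulVec]
    rfl
  simp only [sum_apply, smul_apply, smul_eq_mul, ContinuousLinearMap.comp_apply,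
    ContinuousLinearMap.proj_apply, hcramer, Matrix.det_apply', Finset.mul_sum]
  rw [Finset.sum_comm]
  refine Finset.sum_congr rfl fun i _ ↦ Finset.sum_congr rfl fun σ _ ↦ ?_
  congr 1
  rw [← Finset.prod_erase_mul _ _ (Finset.mem_univ i)]
  simp only [Matrix.updateCol_self]
  congr 1
  exact Finset.prod_congr rfl fun j hj ↦ by
    rw [Matrix.updateCol_ne (Finset.ne_of_mem_erase hj), Matrix.of_apply]

theorem trace_adjugate_mul_transpose_mul_add_mul {R : Type*} [CommRing R] (W G : Matrix ι ι R) :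
    (W.adjugate * (G.transpose * W + W * G)).trace = 2 * G.trace * W.det := by
  rw [mul_add, Matrix.trace_add, ← mul_assoc, Matrix.trace_mul_comm, ← mul_assoc, ← mul_assoc,
    Matrix.mul_adjugate, Matrix.adjugate_mul]
  simp only [smul_mul_assoc, one_mul, Matrix.trace_smul, Matrix.trace_transpose, smul_eq_mul]
  ring

/-- The determinant of a bilinear form is a relative invariant under change of basis: this is its
derivative along the infinitesimal action of `G`. -/
theorem fderiv_det_transpose_mul_add_mul (W G : Matrix ι ι ℝ) :
    fderiv ℝ (fun B : ι → ι → ℝ ↦ (Matrix.of B).det) (Matrix.of.symm W)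
      (Matrix.of.symm (G.transpose * W + W * G)) = 2 * G.trace * W.det := by
  rw [(hasFDerivAt_det _).fderiv, ← trace_adjugate_mul_transpose_mul_add_mul]
  simp only [sum_apply, smul_apply, smul_eq_mul, ContinuousLinearMap.comp_apply,
    ContinuousLinearMap.proj_apply]
  rfl

end

section

/-! ## Uniqueness for linear differential inequalities -/

variable {E : Type*} [NormedAddCommGroup E] [NormedSpace ℝ E]
  {F : Type*} [NormedAddCommGroup F] [NormedSpace ℝ F]

theorem eq_zero_of_norm_fderivWithin_le {f : E → F} {f' : E → E →L[ℝ] F} {s : Set E} {C : ℝ}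
    (hs : Convex ℝ s) (hf : ∀ p ∈ s, HasFDerivWithinAt f (f' p) s p)
    (hC : ∀ p ∈ s, ‖f' p‖ ≤ C * ‖f p‖) {p q : E} (hp : p ∈ s) (hq : q ∈ s) (hfp : f p = 0) :
    f q = 0 := by
  let γ : ℝ → E := AffineMap.lineMap p q
  have hγ : MapsTo γ (Icc 0 1) s := fun t ht ↦ hs.lineMap_mem hp hq ht
  have hderiv : ∀ t ∈ Icc (0 : ℝ) 1,
      HasDerivWithinAt (f ∘ γ) (f' (γ t) (q - p)) (Icc 0 1) t := fun t ht ↦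
    (hf _ (hγ ht)).comp_hasDerivWithinAt t AffineMap.hasDerivWithinAt_lineMap hγ
  have hgronwall := norm_le_gronwallBound_of_norm_deriv_right_le (f := f ∘ γ) (δ := 0)
    (K := C * ‖q - p‖) (ε := 0) (a := 0) (b := 1)
    (fun t ht ↦ (hderiv t ht).continuousWithinAt)
    (fun t ht ↦ (hderiv t (Ico_subset_Icc_self ht)).mono_of_mem_nhdsWithin
      (Icc_mem_nhdsGE_of_mem ht))
    (by simp [γ, hfp])
    (fun t ht ↦ by
      calc ‖f' (γ t) (q - p)‖ ≤ ‖f' (γ t)‖ * ‖q - p‖ := (f' (γ t)).le_opNorm _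
        _ ≤ C * ‖f (γ t)‖ * ‖q - p‖ := by gcongr; exact hC _ (hγ (Ico_subset_Icc_self ht))
        _ = C * ‖q - p‖ * ‖(f ∘ γ) t‖ + 0 := by rw [Function.comp_apply]; ring)
    1 (by simp)
  simpa [gronwallBound, γ] using hgronwall

variable {M : Type*} [TopologicalSpace M] [ChartedSpace E M] [IsManifold 𝓘(ℝ, E) ∞ M]

theorem hasFDerivAt_comp_chart_symm {c : M} {f : M → F} {p : E} (hp : p ∈ (chartAt E c).target)
    (hf : MDiffAt f ((chartAt E c).symm p)) :
    HasFDerivAt (f ∘ (chartAt E c).symm) (coordDeriv (E := E) c f ((chartAt E c).symm p)) p := by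
  rw [coordDeriv_eq_fderiv ((chartAt E c).map_target hp) hf, (chartAt E c).right_inv hp]
  exact (hf.comp p
    (mdifferentiableAt_atlas_symm (chart_mem_atlas E c) hp)).differentiableAt.hasFDerivAt

theorem eventually_eq_zero_of_norm_coordDeriv_le {c : M} {f : M → F} {C : ℝ} (hfc : f c = 0)
    (hf : ∀ᶠ y in 𝓝 c, MDiffAt f y) (hC : ∀ᶠ y in 𝓝 c, ‖coordDeriv (E := E) c f y‖ ≤ C * ‖f y‖) :
    ∀ᶠ y in 𝓝 c, f y = 0 := by
  let φ := chartAt E c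
  have hc : c ∈ φ.source := mem_chart_source E c
  have hsymm : Filter.Tendsto φ.symm (𝓝 (φ c)) (𝓝 c) := by
    simpa only [φ.left_inv hc] using (φ.continuousAt_symm (φ.map_source hc)).tendsto
  obtain ⟨r, hr, hball⟩ := Metric.eventually_nhds_iff_ball.1
    ((hsymm.eventually (hf.and hC)).and (φ.open_target.mem_nhds (φ.map_source hc)))
  have hzero (p : E) (hp : p ∈ Metric.ball (φ c) r) : f (φ.symm p) = 0 :=
    eq_zero_of_norm_fderivWithin_le (convex_ball (φ c) r)
      (fun p hp ↦ (hasFDerivAt_comp_chart_symm (hball p hp).2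
        (hball p hp).1.1).hasFDerivWithinAt)
      (fun p hp ↦ (hball p hp).1.2) (Metric.mem_ball_self hr) hp
      (by rw [Function.comp_apply, φ.left_inv hc, hfc])
  filter_upwards [φ.open_source.mem_nhds hc,
    (φ.continuousAt hc).preimage_mem_nhds (Metric.ball_mem_nhds _ hr)] with y hy hyr
  simpa only [φ.left_inv hy] using hzero (φ y) hyr

end

section

/-! ## Torsion-free and parallel at a point -/

variable {E : Type*} [NormedAddCommGroup E] [NormedSpace ℝ E]
  {M : Type*} [TopologicalSpace M] [ChartedSpace E M] [IsManifold 𝓘(ℝ, E) ∞ M]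
  {cov : TangentField E M → EndoField E M} {q : BilinField E M} {s : Set M} {x : M}

theorem mdifferentiableAt_bilin_apply (hq : SmoothBilinOn q s) (hs : s ∈ 𝓝 x)
    {Y Z : TangentField E M} (hY : MDiffAt (T% Y) x) (hZ : MDiffAt (T% Z) x) :
    MDiffAt (fun y ↦ q y (Y y) (Z y)) x := by
  have : MDifferentiableAt 𝓘(ℝ, E) (𝓘(ℝ, E).prod 𝓘(ℝ))
      (fun m ↦ TotalSpace.mk' ℝ (E := Bundle.Trivial M ℝ) m (q m (Y m) (Z m))) x := by
    apply MDifferentiableAt.clm_bundle_apply₂ (F₁ := E) (F₂ := E)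
    · exact (hq.contMDiffAt hs).mdifferentiableAt (by simp)
    · exact hY
    · exact hZ
  simp only [mdifferentiableAt_totalSpace] at this
  exact this.2

/-- The torsion `∇_X Y - ∇_Y X - [X, Y]` at `x` of an operator `cov` on vector fields. As in
`CovariantDerivative`, `cov Y x u` stands for the derivative `∇_u Y` at `x`. -/
def torsionAt (cov : TangentField E M → EndoField E M) (x : M) (X Y : TangentField E M) :
    TangentSpace 𝓘(ℝ, E) x :=
  cov Y x (X x) - cov X x (Y x) - VectorField.mlieBracket 𝓘(ℝ, E) X Y x

/-- The value at `x` of `(∇_u q)(Y, Z) = u q(Y, Z) - q(∇_u Y, Z) - q(Y, ∇_u Z)`. -/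
def bilinDerivAt (cov : TangentField E M → EndoField E M) (q : BilinField E M) (x : M)
    (u : TangentSpace 𝓘(ℝ, E) x) (Y Z : TangentField E M) : ℝ :=
  d% (fun y ↦ q y (Y y) (Z y)) x u - q x (cov Y x u) (Z x) - q x (Y x) (cov Z x u)

/-- The torsion of the operator `cov` on vector fields vanishes at `x`. -/
def IsTorsionFreeAt (cov : TangentField E M → EndoField E M) (x : M) : Prop :=
  ∀ ⦃X Y : TangentField E M⦄, MDiffAt (T% X) x → MDiffAt (T% Y) x → torsionAt cov x X Y = 0

/-- The field of bilinear forms `q` satisfies `∇q = 0` at `x`, where `∇` is the operator `cov` on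
vector fields. -/
def IsParallelAt (cov : TangentField E M → EndoField E M) (q : BilinField E M) (x : M) : Prop :=
  ∀ ⦃Y Z : TangentField E M⦄, MDiffAt (T% Y) x → MDiffAt (T% Z) x →
    ∀ u, bilinDerivAt cov q x u Y Z = 0

theorem IsTorsionFreeAt.sub_eq_mlieBracket (h : IsTorsionFreeAt cov x) {X Y : TangentField E M}
    (hX : MDiffAt (T% X) x) (hY : MDiffAt (T% Y) x) :
    cov Y x (X x) - cov X x (Y x) = VectorField.mlieBracket 𝓘(ℝ, E) X Y x :=
  sub_eq_zero.1 (h hX hY)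

omit [IsManifold 𝓘(ℝ, E) ∞ M] in
theorem bilinDerivAt_eq_zero_iff {u : TangentSpace 𝓘(ℝ, E) x} {Y Z : TangentField E M} :
    bilinDerivAt cov q x u Y Z = 0 ↔
      d% (fun y ↦ q y (Y y) (Z y)) x u = q x (cov Y x u) (Z x) + q x (Y x) (cov Z x u) := by
  rw [bilinDerivAt, sub_sub, sub_eq_zero]

variable [FiniteDimensional ℝ E]

theorem eq_zero_of_tensorialAt₂ {V : Type*} [AddCommGroup V] [Module ℝ V]
    {Φ : TangentField E M → TangentField E M → V}
    (hleft : ∀ Y, MDiffAt (T% Y) x → TensorialAt 𝓘(ℝ, E) E (Φ · Y) x)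
    (hright : ∀ X, MDiffAt (T% X) x → TensorialAt 𝓘(ℝ, E) E (Φ X ·) x)
    (h : ∀ u v, ∃ X Y, MDiffAt (T% X) x ∧ MDiffAt (T% Y) x ∧ X x = u ∧ Y x = v ∧ Φ X Y = 0)
    {X Y : TangentField E M} (hX : MDiffAt (T% X) x) (hY : MDiffAt (T% Y) x) : Φ X Y = 0 := by
  obtain ⟨X', Y', hX', hY', hXX', hYY', h0⟩ := h (X x) (Y x)
  exact (TensorialAt.pointwise₂ hleft hright hX hX' hY hY' hXX'.symm hYY'.symm).trans h0

theorem tensorialAt_torsionAt_left (hcov : IsCovariantDerivativeOn E cov s) (hx : x ∈ s)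
    (Y : TangentField E M) : TensorialAt 𝓘(ℝ, E) E (torsionAt cov x · Y) x where
  smul hf hX := by
    simp [torsionAt, hcov.leibniz hX hf hx, VectorField.mlieBracket_smul_left hf hX]
    module
  add hX hX' := by
    simp [torsionAt, hcov.add hX hX' hx, VectorField.mlieBracket_add_left hX hX']
    module

theorem tensorialAt_torsionAt_right (hcov : IsCovariantDerivativeOn E cov s) (hx : x ∈ s)
    (X : TangentField E M) : TensorialAt 𝓘(ℝ, E) E (torsionAt cov x X ·) x where
  smul hf hY := by
    simp [torsionAt, hcov.leibniz hY hf hx, VectorField.mlieBracket_smul_right hf hY]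
    module
  add hY hY' := by
    simp [torsionAt, hcov.add hY hY' hx, VectorField.mlieBracket_add_right hY hY']
    module

theorem isTorsionFreeAt_of_forall_exists (hcov : IsCovariantDerivativeOn E cov s) (hx : x ∈ s)
    (h : ∀ u v, ∃ X Y, MDiffAt (T% X) x ∧ MDiffAt (T% Y) x ∧ X x = u ∧ Y x = v ∧
      torsionAt cov x X Y = 0) : IsTorsionFreeAt cov x := fun _ _ ↦
  eq_zero_of_tensorialAt₂ (fun Y _ ↦ tensorialAt_torsionAt_left hcov hx Y)
    (fun X _ ↦ tensorialAt_torsionAt_right hcov hx X) h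

omit [FiniteDimensional ℝ E] in
theorem tensorialAt_bilinDerivAt_left (hcov : IsCovariantDerivativeOn E cov s) (hs : s ∈ 𝓝 x)
    (hq : SmoothBilinOn q s) (u : TangentSpace 𝓘(ℝ, E) x) {Z : TangentField E M}
    (hZ : MDiffAt (T% Z) x) : TensorialAt 𝓘(ℝ, E) E (bilinDerivAt cov q x u · Z) x where
  smul hf hY := by
    have h := mvfderiv_fun_mul hf (mdifferentiableAt_bilin_apply hq hs hY hZ)
    simp [bilinDerivAt, hcov.leibniz hY hf (mem_of_mem_nhds hs), h]
    ring
  add hY hY' := by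
    have h := mvfderiv_fun_add (mdifferentiableAt_bilin_apply hq hs hY hZ)
      (mdifferentiableAt_bilin_apply hq hs hY' hZ)
    simp [bilinDerivAt, hcov.add hY hY' (mem_of_mem_nhds hs), h]
    ring

omit [FiniteDimensional ℝ E] in
theorem tensorialAt_bilinDerivAt_right (hcov : IsCovariantDerivativeOn E cov s) (hs : s ∈ 𝓝 x)
    (hq : SmoothBilinOn q s) (u : TangentSpace 𝓘(ℝ, E) x) {Y : TangentField E M}
    (hY : MDiffAt (T% Y) x) : TensorialAt 𝓘(ℝ, E) E (bilinDerivAt cov q x u Y ·) x where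
  smul hf hZ := by
    have h := mvfderiv_fun_mul hf (mdifferentiableAt_bilin_apply hq hs hY hZ)
    simp [bilinDerivAt, hcov.leibniz hZ hf (mem_of_mem_nhds hs), h]
    ring
  add hZ hZ' := by
    have h := mvfderiv_fun_add (mdifferentiableAt_bilin_apply hq hs hY hZ)
      (mdifferentiableAt_bilin_apply hq hs hY hZ')
    simp [bilinDerivAt, hcov.add hZ hZ' (mem_of_mem_nhds hs), h]
    ring

theorem isParallelAt_of_forall_exists (hcov : IsCovariantDerivativeOn E cov s) (hs : s ∈ 𝓝 x)
    (hq : SmoothBilinOn q s)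
    (h : ∀ u v w, ∃ Y Z, MDiffAt (T% Y) x ∧ MDiffAt (T% Z) x ∧ Y x = v ∧ Z x = w ∧
      bilinDerivAt cov q x u Y Z = 0) : IsParallelAt cov q x := fun _ _ hY hZ u ↦
  eq_zero_of_tensorialAt₂ (fun _ ↦ tensorialAt_bilinDerivAt_left hcov hs hq u)
    (fun _ ↦ tensorialAt_bilinDerivAt_right hcov hs hq u) (h u) hY hZ

variable [T2Space M]

theorem smoothEndoOn_covariantDerivative
    {D : CovariantDerivative 𝓘(ℝ, E) E (TangentSpace 𝓘(ℝ, E) : M → Type _)}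
    (hD : D.ContMDiffCovariantDerivative ∞) {U : Set M} (hU : IsOpen U) {σ : TangentField E M}
    (hσ : CMDiff[U] ∞ (T% σ)) : SmoothEndoOn (D σ) U := by
  intro y hy
  obtain ⟨σ', hσ', heq⟩ := exists_contMDiff_eventuallyEq (hU.mem_nhds hy) hσ
  have hDσ' : SmoothEndoOn (D σ') univ :=
    hD.contMDiff.contMDiff (by simpa using hσ'.contMDiffOn)
  have hdiff {τ : TangentField E M} {V : Set M} (hτ : CMDiff[V] ∞ (T% τ)) {z : M} (hV : V ∈ 𝓝 z) :
      MDiffAt (T% τ) z := (hτ.contMDiffAt hV).mdifferentiableAt (by simp)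
  refine (((hDσ' y trivial).contMDiffAt Filter.univ_mem).congr_of_eventuallyEq
    ?_).contMDiffWithinAt
  filter_upwards [hU.mem_nhds hy, heq.eventually_nhds] with z hz hzeq
  exact congrArg _ (D.isCovariantDerivativeOn.congr_of_eventuallyEq (hdiff hσ (hU.mem_nhds hz))
    (hdiff hσ'.contMDiffOn Filter.univ_mem) Filter.univ_mem (hzeq.mono fun _ ↦ Eq.symm))

end

section

/-! ## Parallel bilinear forms have constant rank -/

variable {E : Type*} [NormedAddCommGroup E] [NormedSpace ℝ E]
  {M : Type*} [TopologicalSpace M] [ChartedSpace E M] [IsManifold 𝓘(ℝ, E) ∞ M]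
  {cov : TangentField E M → EndoField E M} {q : BilinField E M} {c y : M}

theorem bilinDerivAt_coordFrame_eq_zero_iff (hy : y ∈ (chartAt E c).source)
    (hq : SmoothBilinOn q (chartAt E c).source) {u e f : E} :
    bilinDerivAt cov q y (coordFrame c y u) (coordFrame c · e) (coordFrame c · f) = 0 ↔
      coordDeriv c (coordBilin c q) y u e f =
        coordBilin c q y (coordEndo c (cov (coordFrame c · e)) y u) f +
          coordBilin c q y e (coordEndo c (cov (coordFrame c · f)) y u) := by
  rw [bilinDerivAt_eq_zero_iff, coordDeriv_coordBilin_apply hq hy]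
  simp only [coordBilin_apply, coordFrame_coordEndo hy]

theorem IsParallelAt.coordDeriv_coordBilin_apply (h : IsParallelAt cov q y)
    (hy : y ∈ (chartAt E c).source) (hq : SmoothBilinOn q (chartAt E c).source) (u e f : E) :
    coordDeriv c (coordBilin c q) y u e f =
      coordBilin c q y (coordEndo c (cov (coordFrame c · e)) y u) f +
        coordBilin c q y e (coordEndo c (cov (coordFrame c · f)) y u) :=
  (bilinDerivAt_coordFrame_eq_zero_iff hy hq).1
    (h (mdifferentiableAt_coordFrame hy e) (mdifferentiableAt_coordFrame hy f) _)

variable [FiniteDimensional ℝ E]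

variable (E) in
/-- Square matrices of size `dim E`. This is a function space and not `Matrix`, because `Matrix`
carries no canonical norm. -/
abbrev CoordMatrix : Type :=
  Fin (Module.finrank ℝ E) → Fin (Module.finrank ℝ E) → ℝ

/-- The Gram matrix of a field of bilinear forms in the coordinate frame of the chart at `c`. -/
def coordGram (c : M) (q : BilinField E M) (y : M) : CoordMatrix E :=
  fun i j ↦ coordBilin c q y (Module.finBasis ℝ E i) (Module.finBasis ℝ E j)

/-- The determinant of the Gram matrix of a field of bilinear forms in the chart at `c`. -/
def coordDet (c : M) (q : BilinField E M) (y : M) : ℝ :=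
  (Matrix.of (coordGram c q y)).det

/-- The matrix of `cov` differentiating the coordinate frame of the chart at `c` in the direction
of the coordinate field `u`. -/
def coordConnMatrix (c : M) (cov : TangentField E M → EndoField E M) (y : M) (u : E) :
    Matrix (Fin (Module.finrank ℝ E)) (Fin (Module.finrank ℝ E)) ℝ :=
  .of fun k i ↦ (Module.finBasis ℝ E).coord k
    (coordEndo c (cov (coordFrame c · (Module.finBasis ℝ E i))) y u)

/-- The trace of the connection matrix, as a one-form in the chart at `c`. -/
def coordConnTrace (c : M) (cov : TangentField E M → EndoField E M) (y : M) : E →L[ℝ] ℝ :=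
  ∑ i, ((Module.finBasis ℝ E).coord i).toContinuousLinearMap ∘L
    coordEndo c (cov (coordFrame c · (Module.finBasis ℝ E i))) y

theorem trace_coordConnMatrix (u : E) :
    (coordConnMatrix c cov y u).trace = coordConnTrace c cov y u := by
  simp [coordConnMatrix, coordConnTrace, Matrix.trace]

theorem sum_coordConnMatrix_smul (u : E) (i : Fin (Module.finrank ℝ E)) :
    ∑ k, coordConnMatrix c cov y u k i • Module.finBasis ℝ E k =
      coordEndo c (cov (coordFrame c · (Module.finBasis ℝ E i))) y u :=
  (Module.finBasis ℝ E).sum_repr _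

theorem contMDiffOn_coordGram (hq : SmoothBilinOn q (chartAt E c).source) :
    ContMDiffOn 𝓘(ℝ, E) 𝓘(ℝ, CoordMatrix E) ∞ (coordGram c q) (chartAt E c).source :=
  contMDiffOn_pi_space.2 fun _ ↦ contMDiffOn_pi_space.2 fun _ ↦
    ((smoothBilinOn_iff_coordBilin.1 hq).clm_apply contMDiffOn_const).clm_apply contMDiffOn_const

theorem mdifferentiableAt_coordGram (hy : y ∈ (chartAt E c).source)
    (hq : SmoothBilinOn q (chartAt E c).source) :
    MDifferentiableAt 𝓘(ℝ, E) 𝓘(ℝ, CoordMatrix E) (coordGram c q) y :=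
  ((contMDiffOn_coordGram hq).contMDiffAt
    ((chartAt E c).open_source.mem_nhds hy)).mdifferentiableAt (by simp)

theorem coordDeriv_coordGram_apply (hy : y ∈ (chartAt E c).source)
    (hq : SmoothBilinOn q (chartAt E c).source) (u : E) (i j : Fin (Module.finrank ℝ E)) :
    coordDeriv c (coordGram c q) y u i j =
      coordDeriv c (coordBilin c q) y u (Module.finBasis ℝ E i) (Module.finBasis ℝ E j) := by
  have hgram := mdifferentiableAt_coordGram hy hq
  let entry := ContinuousLinearMap.proj (R := ℝ) (φ := fun _ : Fin (Module.finrank ℝ E) ↦ ℝ) j ∘L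
    ContinuousLinearMap.proj (φ := fun _ ↦ Fin (Module.finrank ℝ E) → ℝ) i
  have hentry := coordDeriv_comp (E := E) (c := c) (h := entry) entry.differentiableAt hgram
  rw [entry.fderiv] at hentry
  rw [coordDeriv_coordBilin_apply hq hy]
  exact (DFunLike.congr_fun hentry u).symm

theorem IsParallelAt.coordDeriv_coordGram (h : IsParallelAt cov q y)
    (hy : y ∈ (chartAt E c).source) (hq : SmoothBilinOn q (chartAt E c).source) (u : E) :
    coordDeriv c (coordGram c q) y u = Matrix.of.symm
      ((coordConnMatrix c cov y u).transpose * .of (coordGram c q y) +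
        .of (coordGram c q y) * coordConnMatrix c cov y u) := by
  ext i j
  rw [coordDeriv_coordGram_apply hy hq, h.coordDeriv_coordBilin_apply hy hq,
    ← sum_coordConnMatrix_smul, ← sum_coordConnMatrix_smul]
  simp [Matrix.mul_apply, coordGram, mul_comm]

theorem coordDet_ne_zero_iff (hy : y ∈ (chartAt E c).source) :
    coordDet c q y ≠ 0 ↔ ∀ u, (∀ v, q y u v = 0) → u = 0 := by
  let B : E →ₗ[ℝ] E →ₗ[ℝ] ℝ := (ContinuousLinearMap.coeLM ℝ).comp (coordBilin c q y : _ →ₗ[ℝ] _)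
  have hB : Matrix.of (coordGram c q y) =
      LinearMap.toMatrix₂ (Module.finBasis ℝ E) (Module.finBasis ℝ E) B := by
    ext i j
    simp [coordGram, B, LinearMap.toMatrix₂_apply]
  rw [coordDet, hB, ← LinearMap.separatingLeft_iff_det_ne_zero]
  constructor
  · intro hsep u hu
    have hu0 : coordMap c y u = 0 := hsep _ fun v ↦ by
      change q y (coordFrame c y (coordMap c y u)) (coordFrame c y v) = 0
      rw [coordFrame_coordMap hy]
      exact hu _
    rw [← coordFrame_coordMap hy u, hu0, map_zero]
  · intro hnondeg e he
    have he0 : coordFrame c y e = 0 := hnondeg _ fun v ↦ by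
      rw [← coordFrame_coordMap hy v]
      exact he (coordMap c y v)
    rw [← coordMap_coordFrame hy e, he0, map_zero]

theorem mdifferentiableAt_coordDet (hy : y ∈ (chartAt E c).source)
    (hq : SmoothBilinOn q (chartAt E c).source) : MDiffAt (coordDet c q) y :=
  (hasFDerivAt_det (coordGram c q y)).differentiableAt.mdifferentiableAt.comp y
    (mdifferentiableAt_coordGram hy hq)

/-- Liouville's formula for the connection acting on bilinear forms. -/
theorem IsParallelAt.coordDeriv_coordDet (h : IsParallelAt cov q y)
    (hy : y ∈ (chartAt E c).source) (hq : SmoothBilinOn q (chartAt E c).source) :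
    coordDeriv c (coordDet c q) y = (2 * coordDet c q y) • coordConnTrace c cov y := by
  have hdet := (hasFDerivAt_det (coordGram c q y)).differentiableAt
  ext u
  have hchain : coordDeriv c (coordDet c q) y u =
      fderiv ℝ (fun B : CoordMatrix E ↦ (Matrix.of B).det) (coordGram c q y)
        (coordDeriv c (coordGram c q) y u) :=
    DFunLike.congr_fun (coordDeriv_comp (E := E) hdet (mdifferentiableAt_coordGram hy hq)) u
  rw [hchain, h.coordDeriv_coordGram hy hq]
  refine (fderiv_det_transpose_mul_add_mul (.of (coordGram c q y)) _).trans ?_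
  rw [trace_coordConnMatrix]
  exact mul_right_comm _ _ _

variable [T2Space M] {D : CovariantDerivative 𝓘(ℝ, E) E (TangentSpace 𝓘(ℝ, E) : M → Type _)}

theorem continuousAt_coordConnTrace (hD : D.ContMDiffCovariantDerivative ∞) :
    ContinuousAt (coordConnTrace c D) c := by
  refine tendsto_finsetSum _ fun i _ ↦ ?_
  have hDi := smoothEndoOn_iff_coordEndo.1 (smoothEndoOn_covariantDerivative hD
    (chartAt E c).open_source (contMDiffOn_coordFrame (c := c) (Module.finBasis ℝ E i)))
  exact continuousAt_const.clm_comp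
    (hDi.continuousOn.continuousAt (chart_source_mem_nhds E c))

theorem eventually_coordDet_eq_zero (hD : D.ContMDiffCovariantDerivative ∞)
    (hq : SmoothBilinOn q (chartAt E c).source) (h : ∀ y, IsParallelAt D q y)
    (h0 : coordDet c q c = 0) : ∀ᶠ y in 𝓝 c, coordDet c q y = 0 := by
  have hU := chart_source_mem_nhds E c
  have hbound := (continuousAt_coordConnTrace (c := c) hD).norm.eventually_lt continuousAt_const
    (lt_add_one _)
  refine eventually_eq_zero_of_norm_coordDeriv_le (C := 2 * (‖coordConnTrace c D c‖ + 1)) h0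
    (Filter.mem_of_superset hU fun y hy ↦ mdifferentiableAt_coordDet hy hq) ?_
  filter_upwards [hU, hbound] with y hy hθ
  rw [(h y).coordDeriv_coordDet hy hq, norm_smul, norm_mul, Real.norm_two, mul_right_comm]
  gcongr

theorem nondegenerate_of_isParallelAt [ConnectedSpace M] (hD : D.ContMDiffCovariantDerivative ∞)
    (hq : SmoothBilinOn q univ) (h : ∀ y, IsParallelAt D q y) {x : M}
    (hx : ∀ u, (∀ v, q x u v = 0) → u = 0) (y : M) : ∀ u, (∀ v, q y u v = 0) → u = 0 := by
  have hqc (c : M) := hq.mono (subset_univ (chartAt E c).source)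
  let S : Set M := {y | ∀ u, (∀ v, q y u v = 0) → u = 0}
  have hS {c y : M} (hy : y ∈ (chartAt E c).source) : coordDet c q y ≠ 0 ↔ y ∈ S :=
    coordDet_ne_zero_iff hy
  have hclosed : IsClosed S := by
    refine isOpen_compl_iff.1 (isOpen_iff_mem_nhds.2 fun c hc ↦ ?_)
    have h0 : coordDet c q c = 0 := not_ne_iff.1 fun h ↦ hc ((hS (mem_chart_source E c)).1 h)
    filter_upwards [chart_source_mem_nhds E c, eventually_coordDet_eq_zero hD (hqc c) h h0]
      with y hy hy0 hyS
    exact (hS hy).2 hyS hy0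
  have hopen : IsOpen S := by
    refine isOpen_iff_mem_nhds.2 fun c hc ↦ ?_
    filter_upwards [chart_source_mem_nhds E c,
      (mdifferentiableAt_coordDet (mem_chart_source E c) (hqc c)).continuousAt.eventually_ne
        ((hS (mem_chart_source E c)).2 hc)] with y hy hy0
    exact (hS hy).1 hy0
  exact (IsClopen.eq_univ ⟨hclosed, hopen⟩ ⟨x, hx⟩).ge (mem_univ y)

end

section

variable {V W F : Type*} [NormedAddCommGroup V] [NormedSpace ℝ V] [NormedAddCommGroup W]
  [NormedSpace ℝ W] [NormedAddCommGroup F] [NormedSpace ℝ F]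

theorem contDiff_flip : ContDiff ℝ ∞ (fun f : V →L[ℝ] W →L[ℝ] F ↦ f.flip) :=
  IsBoundedLinearMap.contDiff (𝕜 := ℝ)
    ⟨⟨fun _ _ ↦ rfl, fun _ _ ↦ rfl⟩, 1, one_pos, fun f ↦ by rw [one_mul, f.opNorm_flip]⟩

end

section

/-! ## From a gauge solution to a symplectic structure -/

theorem eq_neg_swap_of_self_eq_zero {V : Type*} [AddCommGroup V] [Module ℝ V] [TopologicalSpace V]
    {B : V →L[ℝ] V →L[ℝ] ℝ} (h : ∀ u, B u u = 0) (u v : V) : B u v = -B v u := by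
  have huv := h (u + v)
  simp only [map_add, add_apply, h, zero_add, add_zero] at huv
  linarith

variable {E : Type*} [NormedAddCommGroup E] [NormedSpace ℝ E] [FiniteDimensional ℝ E]
  {M : Type*} [TopologicalSpace M] [ChartedSpace E M] [IsManifold 𝓘(ℝ, E) ∞ M]

theorem TorsionFreeConnection.isTorsionFreeAt (D : TorsionFreeConnection E M) (x : M) :
    IsTorsionFreeAt D.conn x := fun _ _ hX hY ↦
  sub_eq_zero.2 (D.conn.torsion_eq_zero_iff.1 D.torsion_eq_zero hX hY)

namespace PseudoRiemannianMetric

variable (g : PseudoRiemannianMetric E M) (φ : InfinitesimalGauge E M)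

/-- `skewForm` as a field of continuous bilinear forms. -/
def skewBilin : BilinField E M := fun x ↦
  LinearMap.toContinuousLinearMap (LinearMap.toContinuousLinearMap.toLinearMap ∘ₗ g.skewForm φ x)

theorem skewBilin_apply (x : M) (u v : TangentSpace 𝓘(ℝ, E) x) :
    g.skewBilin φ x u v = (1 / 2 : ℝ) * (g.val x (φ.val x u) v - g.val x u (φ.val x v)) := rfl

theorem skewBilin_self (x : M) (u : TangentSpace 𝓘(ℝ, E) x) : g.skewBilin φ x u u = 0 := by
  rw [skewBilin_apply, g.symm, sub_self, mul_zero]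

theorem smoothBilinOn_skewBilin : SmoothBilinOn (g.skewBilin φ) univ := by
  refine contMDiffOn_univ.2 (contMDiff_of_contMDiffOn_chart_source fun c ↦ ?_)
  refine smoothBilinOn_iff_coordBilin.2 ?_
  have hgφ := (smoothBilinOn_iff_coordBilin.1 (g.contMDiff.contMDiffOn (s := (chartAt E c).source))
    ).clm_comp (smoothEndoOn_iff_coordEndo.1 φ.contMDiff.contMDiffOn)
  have hflip := contDiff_flip.contMDiff.comp_contMDiffOn hgφ
  refine ((contDiff_const_smul (1 / 2 : ℝ)).contMDiff.comp_contMDiffOn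
    (hgφ.sub hflip)).congr fun y hy ↦ ?_
  ext u v
  simp [coordBilin_apply, coordFrame_coordEndo hy, skewBilin_apply,
    g.symm y _ (φ.val y (coordFrame c y v))]

variable {g φ} {x : M}

theorem nondegenerate_skewBilin_of_corankAt_eq_zero (h : g.corankAt φ x = 0)
    (u : TangentSpace 𝓘(ℝ, E) x) (hu : ∀ v, g.skewBilin φ x u v = 0) : u = 0 := by
  have hsurj : Function.Surjective (g.skewPart φ x) := by
    rw [← LinearMap.range_eq_top]
    exact Submodule.eq_top_of_finrank_eq
      (le_antisymm (Submodule.finrank_le _) (Nat.sub_eq_zero_iff_le.1 h))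
  refine LinearMap.injective_iff_surjective.2 hsurj ?_
  rw [map_zero]
  exact g.nondegenerate x _ fun v ↦ (g.val_skewPart φ x u v).trans (hu v)

variable [T2Space M] {D : TorsionFreeConnection E M} {Y Z : TangentField E M}

theorem mvfderiv_val_gauge (hφ : φ ∈ g.gaugeSolutions D) (hY : CMDiff ∞ (T% Y))
    (hZ : MDiffAt (T% Z) x) (u : TangentSpace 𝓘(ℝ, E) x) :
    d% (fun y ↦ g.val y (φ.val y (Y y)) (Z y)) x u =
      g.val x (φ.val x (D.conn Y x u)) (Z x) + g.val x (φ.val x (Y x)) (D.conn Z x u) := by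
  have hφY : MDiffAt (T% fun y ↦ φ.val y (Y y)) x :=
    (φ.contMDiff.clm_bundle_apply hY).mdifferentiableAt (by simp)
  obtain ⟨X, hX, rfl⟩ := exists_contMDiff_apply_eq u
  rw [← hφ X Y hX hY x, g.dualConnection_apply D.conn hφY hZ, sub_add_cancel]

theorem isParallelAt_skewBilin (hφ : φ ∈ g.gaugeSolutions D) (x : M) :
    IsParallelAt D.conn (g.skewBilin φ) x := by
  refine isParallelAt_of_forall_exists D.conn.isCovariantDerivativeOn Filter.univ_mem
    (g.smoothBilinOn_skewBilin φ) fun u v w ↦ ?_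
  obtain ⟨Y, hY, rfl⟩ := exists_contMDiff_apply_eq v
  obtain ⟨Z, hZ, rfl⟩ := exists_contMDiff_apply_eq w
  have hYx : MDiffAt (T% Y) x := hY.mdifferentiableAt (by simp)
  have hZx : MDiffAt (T% Z) x := hZ.mdifferentiableAt (by simp)
  refine ⟨Y, Z, hYx, hZx, rfl, rfl, bilinDerivAt_eq_zero_iff.2 ?_⟩
  have hdiff {Y Z : TangentField E M} (hY : CMDiff ∞ (T% Y)) (hZ : MDiffAt (T% Z) x) :
      MDiffAt (fun y ↦ g.val y (φ.val y (Y y)) (Z y)) x :=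
    g.mdifferentiableAt_apply ((φ.contMDiff.clm_bundle_apply hY).mdifferentiableAt (by simp)) hZ
  have hskew : (fun y ↦ g.skewBilin φ y (Y y) (Z y)) = fun y ↦ (1 / 2 : ℝ) *
      ((fun y ↦ g.val y (φ.val y (Y y)) (Z y)) - fun y ↦ g.val y (φ.val y (Z y)) (Y y)) y := by
    ext y
    simp [skewBilin_apply, g.symm y (Y y)]
  rw [hskew, mvfderiv_fun_mul mdifferentiableAt_const ((hdiff hY hZx).sub (hdiff hZ hYx)),
    mvfderiv_sub (hdiff hY hZx) (hdiff hZ hYx)]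
  simp [mvfderiv_val_gauge hφ hY hZx, mvfderiv_val_gauge hφ hZ hYx, skewBilin_apply,
    g.symm x _ (φ.val x _), mvfderiv_const]
  ring

end PseudoRiemannianMetric

omit [FiniteDimensional ℝ E] in
theorem closed_of_isParallelAt {cov : TangentField E M → EndoField E M} {q : BilinField E M} {x : M}
    (hcov : IsTorsionFreeAt cov x) (hq : IsParallelAt cov q x) (halt : ∀ u, q x u u = 0)
    {X Y Z : TangentField E M} (hX : MDiffAt (T% X) x) (hY : MDiffAt (T% Y) x)
    (hZ : MDiffAt (T% Z) x) :
    d% (fun y ↦ q y (Y y) (Z y)) x (X x) - d% (fun y ↦ q y (X y) (Z y)) x (Y x)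
      + d% (fun y ↦ q y (X y) (Y y)) x (Z x)
      - q x (VectorField.mlieBracket 𝓘(ℝ, E) X Y x) (Z x)
      + q x (VectorField.mlieBracket 𝓘(ℝ, E) X Z x) (Y x)
      - q x (VectorField.mlieBracket 𝓘(ℝ, E) Y Z x) (X x) = 0 := by
  have hderiv {Y Z : TangentField E M} (hY : MDiffAt (T% Y) x) (hZ : MDiffAt (T% Z) x)
      (u : TangentSpace 𝓘(ℝ, E) x) := bilinDerivAt_eq_zero_iff.1 (hq hY hZ u)
  rw [hderiv hY hZ, hderiv hX hZ, hderiv hX hY, ← hcov.sub_eq_mlieBracket hX hY,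
    ← hcov.sub_eq_mlieBracket hX hZ, ← hcov.sub_eq_mlieBracket hY hZ]
  simp only [map_sub, sub_apply]
  have hswap := eq_neg_swap_of_self_eq_zero halt
  rw [hswap (cov Z x (X x)) (Y x), hswap (cov Z x (Y x)) (X x), hswap (cov Y x (Z x)) (X x)]
  ring

/-- A nondegenerate alternating form that is parallel for a torsion-free connection, as a
symplectic structure. -/
def TorsionFreeConnection.toSymplecticStructure (D : TorsionFreeConnection E M)
    {q : BilinField E M} (hq : SmoothBilinOn q univ) (hpar : ∀ x, IsParallelAt D.conn q x)
    (halt : ∀ x u, q x u u = 0) (hnondeg : ∀ x u, (∀ v, q x u v = 0) → u = 0) :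
    SymplecticStructure E M where
  val := q
  alt := halt
  nondegenerate := hnondeg
  contMDiff := contMDiffOn_univ.1 hq
  closed _ _ _ hX hY hZ x :=
    closed_of_isParallelAt (D.isTorsionFreeAt x) (hpar x) (halt x)
      (hX.mdifferentiableAt (by simp)) (hY.mdifferentiableAt (by simp))
      (hZ.mdifferentiableAt (by simp))

theorem nonempty_symplecticStructure_of_symplecticGap_eq_zero [T2Space M] [ConnectedSpace M]
    (h : symplecticGap E M = 0) : Nonempty (SymplecticStructure E M) := by
  simp only [symplecticGap, PseudoRiemannianMetric.gap, ENat.iInf_eq_zero, Nat.cast_eq_zero] at h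
  obtain ⟨D, g, φ, hφ, x, hx⟩ := h
  have hsmooth := g.smoothBilinOn_skewBilin φ
  have hpar := PseudoRiemannianMetric.isParallelAt_skewBilin hφ
  exact ⟨D.toSymplecticStructure hsmooth hpar (g.skewBilin_self φ)
    (nondegenerate_of_isParallelAt D.smooth hsmooth hpar
      (PseudoRiemannianMetric.nondegenerate_skewBilin_of_corankAt_eq_zero hx))⟩

end

section

/-! ## Connections on a chart domain -/

variable {E : Type*} [NormedAddCommGroup E] [NormedSpace ℝ E]
  {M : Type*} [TopologicalSpace M] [ChartedSpace E M] [IsManifold 𝓘(ℝ, E) ∞ M] {c y : M}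
  {Γ : M → E →L[ℝ] E →L[ℝ] E}

/-- The connection on the domain of the chart at `c` with Christoffel symbols `Γ`: in coordinates,
the derivative of `σ` in the direction `u` is `dσ(u) + Γ(σ, u)`. -/
def chartConnection (c : M) (Γ : M → E →L[ℝ] E →L[ℝ] E) (σ : TangentField E M) : EndoField E M :=
  fun y ↦ coordFrame c y ∘L (mvfderiv 𝓘(ℝ, E) (fun z ↦ coordMap c z (σ z) : M → E) y +
    Γ y (coordMap c y (σ y)) ∘L coordMap c y)

theorem isCovariantDerivativeOn_chartConnection :
    IsCovariantDerivativeOn E (chartConnection c Γ) (chartAt E c).source where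
  add {σ τ y} hσ hτ hy := by
    have h := mvfderiv_fun_add (mdifferentiableAt_coordMap hy hσ) (mdifferentiableAt_coordMap hy hτ)
    ext u
    simp [chartConnection, h]
    abel
  leibniz {σ f y} hσ hf hy := by
    have h := mvfderiv_fun_smul hf (mdifferentiableAt_coordMap hy hσ)
    ext u
    simp [chartConnection, h, coordFrame_coordMap hy]
    abel

theorem smoothEndoOn_chartConnection (hΓ : CMDiff[(chartAt E c).source] ∞ Γ)
    {σ : TangentField E M} (hσ : CMDiff[(chartAt E c).source] ∞ (T% σ)) :
    SmoothEndoOn (chartConnection c Γ σ) (chartAt E c).source := by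
  have h := contMDiffOn_section_iff_coordMap.1 hσ
  refine smoothEndoOn_iff_coordEndo.2 (((contMDiffOn_coordDeriv h).add (hΓ.clm_apply h)).congr
    fun y hy ↦ ?_)
  ext e
  simp [coordEndo, chartConnection, coordDeriv, coordMap_coordFrame hy]

theorem chartConnection_coordFrame (hy : y ∈ (chartAt E c).source) (e : E) :
    chartConnection c Γ (coordFrame c · e) y = coordFrame c y ∘L Γ y e ∘L coordMap c y := by
  have h : (fun z ↦ coordMap c z (coordFrame c z e) : M → E) =ᶠ[𝓝 y] fun _ ↦ e := by
    filter_upwards [(chartAt E c).open_source.mem_nhds hy] with z hz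
    exact coordMap_coordFrame hz e
  rw [chartConnection, mvfderiv_congr_of_eventuallyEq h, mvfderiv_const, coordMap_coordFrame hy,
    zero_add]

theorem coordEndo_chartConnection_coordFrame (hy : y ∈ (chartAt E c).source) (e : E) :
    coordEndo c (chartConnection c Γ (coordFrame c · e)) y = Γ y e := by
  ext u
  simp [coordEndo, chartConnection_coordFrame hy, coordMap_coordFrame hy]

variable [FiniteDimensional ℝ E]

theorem isTorsionFreeAt_chartConnection (hy : y ∈ (chartAt E c).source)
    (hΓ : ∀ e f, Γ y e f = Γ y f e) : IsTorsionFreeAt (chartConnection c Γ) y := by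
  have : CompleteSpace E := FiniteDimensional.complete ℝ E
  refine isTorsionFreeAt_of_forall_exists isCovariantDerivativeOn_chartConnection hy fun u v ↦ ?_
  refine ⟨(coordFrame c · (coordMap c y u)), (coordFrame c · (coordMap c y v)),
    mdifferentiableAt_coordFrame hy _, mdifferentiableAt_coordFrame hy _,
    coordFrame_coordMap hy u, coordFrame_coordMap hy v, ?_⟩
  simp [torsionAt, chartConnection_coordFrame hy, mlieBracket_coordFrame hy,
    coordMap_coordFrame hy, hΓ (coordMap c y u)]

theorem isParallelAt_chartConnection {q : BilinField E M}
    (hq : SmoothBilinOn q (chartAt E c).source) (hy : y ∈ (chartAt E c).source)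
    (hΓ : ∀ u e f, coordDeriv c (coordBilin c q) y u e f =
      coordBilin c q y (Γ y e u) f + coordBilin c q y e (Γ y f u)) :
    IsParallelAt (chartConnection c Γ) q y := by
  refine isParallelAt_of_forall_exists isCovariantDerivativeOn_chartConnection
    ((chartAt E c).open_source.mem_nhds hy) hq fun u v w ↦ ?_
  refine ⟨(coordFrame c · (coordMap c y v)), (coordFrame c · (coordMap c y w)),
    mdifferentiableAt_coordFrame hy _, mdifferentiableAt_coordFrame hy _,
    coordFrame_coordMap hy v, coordFrame_coordMap hy w, ?_⟩
  rw [← coordFrame_coordMap hy u, bilinDerivAt_coordFrame_eq_zero_iff hy hq,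
    coordEndo_chartConnection_coordFrame hy, coordEndo_chartConnection_coordFrame hy]
  exact hΓ ..

end

section

/-! ## Gluing connections -/

variable {E : Type*} [NormedAddCommGroup E] [NormedSpace ℝ E]
  {M : Type*} [TopologicalSpace M] [ChartedSpace E M] [IsManifold 𝓘(ℝ, E) ∞ M]
  {ι : Type*} {ρ : SmoothPartitionOfUnity ι 𝓘(ℝ, E) M univ} {U : ι → Set M} {x : M}

omit [IsManifold 𝓘(ℝ, E) ∞ M] in
theorem mem_of_mem_finsupport_of_isSubordinate (h : ρ.IsSubordinate U) {i : ι}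
    (hi : i ∈ ρ.finsupport x) : x ∈ U i :=
  h i (subset_closure ((ρ.mem_finsupport x).1 hi))

variable (hρ : ρ.IsSubordinate U) {cov : ι → TangentField E M → EndoField E M}
  (hcov : ∀ i, IsCovariantDerivativeOn E (cov i) (U i))

/-- The combination of the local connections `cov i` by a partition of unity. -/
def gluedConnection : CovariantDerivative 𝓘(ℝ, E) E (TangentSpace 𝓘(ℝ, E) : M → Type _) where
  toFun σ x := ∑ i ∈ ρ.finsupport x, ρ i x • cov i σ x
  isCovariantDerivativeOnUniv :=
    { add := fun {σ τ x} hσ hτ _ ↦ by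
        rw [← Finset.sum_add_distrib]
        refine Finset.sum_congr rfl fun i hi ↦ ?_
        rw [(hcov i).add hσ hτ (mem_of_mem_finsupport_of_isSubordinate hρ hi), smul_add]
      leibniz := fun {σ f x} hσ hf _ ↦ by
        rw [Finset.smul_sum]
        trans ∑ i ∈ ρ.finsupport x,
          (f x • ρ i x • cov i σ x + ρ i x • (mvfderiv 𝓘(ℝ, E) f x).smulRight (σ x))
        · refine Finset.sum_congr rfl fun i hi ↦ ?_
          rw [(hcov i).leibniz hσ hf (mem_of_mem_finsupport_of_isSubordinate hρ hi), smul_add,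
            smul_comm]
        · rw [Finset.sum_add_distrib, ← Finset.sum_smul, ρ.sum_finsupport x (mem_univ x),
            one_smul] }

theorem gluedConnection_apply (σ : TangentField E M) (x : M) (u : TangentSpace 𝓘(ℝ, E) x) :
    gluedConnection hρ hcov σ x u = ∑ i ∈ ρ.finsupport x, ρ i x • cov i σ x u := by
  change (∑ i ∈ ρ.finsupport x, ρ i x • cov i σ x) u = _
  simp

variable {hcov}

theorem contMDiffCovariantDerivative_gluedConnection (hU : ∀ i, IsOpen (U i))
    (hsmooth : ∀ i (σ : TangentField E M), CMDiff[U i] ∞ (T% σ) → SmoothEndoOn (cov i σ) (U i)) :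
    (gluedConnection hρ hcov).ContMDiffCovariantDerivative ∞ where
  contMDiff :=
    { contMDiff := fun {σ} hσ ↦ by
        have hterm (i : ι) := ContMDiffOn.smul_section_of_tsupport (ρ i).contMDiff.contMDiffOn
          (hU i) (hρ i) (hsmooth i σ (ContMDiffOn.mono hσ (subset_univ _)))
        refine (ContMDiff.finsum_section_of_locallyFinite
          (ρ.locallyFinite.subset fun i x hx ↦ ?_) hterm).contMDiffOn.congr fun x _ ↦ ?_
        · exact left_ne_zero_of_smul hx
        · congr 1
          exact ρ.sum_finsupport_smul_eq_finsum x fun i _ ↦ cov i σ x }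

theorem torsionAt_gluedConnection (X Y : TangentField E M) :
    torsionAt (gluedConnection hρ hcov) x X Y =
      ∑ i ∈ ρ.finsupport x, ρ i x • torsionAt (cov i) x X Y := by
  simp only [torsionAt, gluedConnection_apply, smul_sub, Finset.sum_sub_distrib]
  rw [← Finset.sum_smul, ρ.sum_finsupport x (mem_univ x), one_smul]

theorem bilinDerivAt_gluedConnection (q : BilinField E M) (u : TangentSpace 𝓘(ℝ, E) x)
    (Y Z : TangentField E M) : bilinDerivAt (gluedConnection hρ hcov) q x u Y Z =
      ∑ i ∈ ρ.finsupport x, ρ i x • bilinDerivAt (cov i) q x u Y Z := by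
  simp only [bilinDerivAt, gluedConnection_apply, smul_sub, Finset.sum_sub_distrib, map_sum,
    map_smul, sum_apply, smul_apply]
  rw [← Finset.sum_smul, ρ.sum_finsupport x (mem_univ x), one_smul]

theorem isTorsionFreeAt_gluedConnection (h : ∀ i, x ∈ U i → IsTorsionFreeAt (cov i) x) :
    IsTorsionFreeAt (gluedConnection hρ hcov) x := fun X Y hX hY ↦ by
  rw [torsionAt_gluedConnection]
  refine Finset.sum_eq_zero fun i hi ↦ ?_
  rw [h i (mem_of_mem_finsupport_of_isSubordinate hρ hi) hX hY, smul_zero]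

theorem isParallelAt_gluedConnection {q : BilinField E M}
    (h : ∀ i, x ∈ U i → IsParallelAt (cov i) q x) :
    IsParallelAt (gluedConnection hρ hcov) q x := fun Y Z hY hZ u ↦ by
  rw [bilinDerivAt_gluedConnection]
  refine Finset.sum_eq_zero fun i hi ↦ ?_
  rw [h i (mem_of_mem_finsupport_of_isSubordinate hρ hi) hY hZ u, smul_zero]

end

section

/-! ## A torsion-free connection preserving a symplectic form -/

variable {V F : Type*} [NormedAddCommGroup V] [NormedSpace ℝ V] [NormedAddCommGroup F]
  [NormedSpace ℝ F]

/-- The bilinear map `(e, f) ↦ A (T e f + T f e) / 3`, which for `A = ω⁻¹` and `T = dω` gives the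
Christoffel symbols of a torsion-free connection preserving a symplectic form `ω`. -/
def symmetrizeComp (A : F →L[ℝ] V) (T : V →L[ℝ] V →L[ℝ] F) : V →L[ℝ] V →L[ℝ] V :=
  ContinuousLinearMap.compL ℝ V F V A ∘L ((1 / 3 : ℝ) • (T + T.flip))

theorem symmetrizeComp_apply (A : F →L[ℝ] V) (T : V →L[ℝ] V →L[ℝ] F) (e f : V) :
    symmetrizeComp A T e f = A ((1 / 3 : ℝ) • (T e f + T f e)) := rfl

set_option synthInstance.maxHeartbeats 400000 in
-- The instances on iterated spaces of continuous linear maps are expensive.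
theorem contMDiffOn_symmetrizeComp {E M : Type*} [NormedAddCommGroup E] [NormedSpace ℝ E]
    [TopologicalSpace M] [ChartedSpace E M] {A : M → F →L[ℝ] V} {T : M → V →L[ℝ] V →L[ℝ] F}
    {s : Set M} (hA : CMDiff[s] ∞ A) (hT : CMDiff[s] ∞ T) :
    CMDiff[s] ∞ (fun y ↦ symmetrizeComp (A y) (T y)) := by
  have hflip := contDiff_flip.contMDiff.comp_contMDiffOn hT
  have hsymm := (contDiff_const_smul (1 / 3 : ℝ)).contMDiff.comp_contMDiffOn (hT.add hflip)
  exact ((ContinuousLinearMap.compL ℝ V F V).contMDiff.comp_contMDiffOn hA).clm_comp hsymm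

end

section

variable {E : Type*} [NormedAddCommGroup E] [NormedSpace ℝ E] [FiniteDimensional ℝ E]

theorem isInvertible_of_nondegenerate {B : E →L[ℝ] E →L[ℝ] ℝ}
    (h : ∀ u, (∀ v, B u v = 0) → u = 0) : B.IsInvertible := by
  have hinj : Function.Injective (B : E →ₗ[ℝ] E →L[ℝ] ℝ) :=
    (injective_iff_map_eq_zero _).2 fun u hu ↦ h u (DFunLike.congr_fun hu)
  have hdim : Module.finrank ℝ E = Module.finrank ℝ (E →L[ℝ] ℝ) := by
    rw [← (LinearMap.toContinuousLinearMap : (E →ₗ[ℝ] ℝ) ≃ₗ[ℝ] E →L[ℝ] ℝ).finrank_eq]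
    exact (Subspace.dual_finrank_eq (K := ℝ) (V := E)).symm
  exact ⟨(LinearEquiv.ofInjectiveOfFinrankEq _ hinj hdim).toContinuousLinearEquiv, rfl⟩

variable {M : Type*} [TopologicalSpace M] [ChartedSpace E M] [IsManifold 𝓘(ℝ, E) ∞ M] {c y : M}

theorem isInvertible_coordBilin (hy : y ∈ (chartAt E c).source) {q : BilinField E M}
    (hq : ∀ u, (∀ v, q y u v = 0) → u = 0) : (coordBilin c q y).IsInvertible := by
  refine isInvertible_of_nondegenerate fun e he ↦ ?_
  have hframe : coordFrame c y e = 0 := hq _ fun v ↦ by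
    rw [← coordFrame_coordMap hy v]
    exact he (coordMap c y v)
  rw [← coordMap_coordFrame hy e, hframe, map_zero]

theorem contMDiffOn_inverse_coordBilin {q : BilinField E M}
    (hq : SmoothBilinOn q (chartAt E c).source)
    (hnondeg : ∀ y ∈ (chartAt E c).source, ∀ u, (∀ v, q y u v = 0) → u = 0) :
    CMDiff[(chartAt E c).source] ∞ (fun y ↦ (coordBilin c q y).inverse) := by
  have : CompleteSpace E := FiniteDimensional.complete ℝ E
  exact fun y hy ↦ (isInvertible_coordBilin hy (hnondeg y hy)).contDiffAt_map_inverse.contMDiffAt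
    |>.comp_contMDiffWithinAt y (smoothBilinOn_iff_coordBilin.1 hq y hy)

namespace SymplecticStructure

variable (S : SymplecticStructure E M)

omit [FiniteDimensional ℝ E] in
theorem val_swap (x : M) (u v : TangentSpace 𝓘(ℝ, E) x) : S.val x u v = -S.val x v u :=
  eq_neg_swap_of_self_eq_zero (S.alt x) u v

omit [FiniteDimensional ℝ E] in
theorem smoothBilinOn (s : Set M) : SmoothBilinOn S.val s :=
  S.contMDiff.contMDiffOn

omit [FiniteDimensional ℝ E] in
theorem coordDeriv_swap (hy : y ∈ (chartAt E c).source) (u e f : E) :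
    coordDeriv c (coordBilin c S.val) y u e f = -coordDeriv c (coordBilin c S.val) y u f e := by
  rw [coordDeriv_coordBilin_apply (S.smoothBilinOn _) hy,
    coordDeriv_coordBilin_apply (S.smoothBilinOn _) hy]
  have hswap : (fun z ↦ S.val z (coordFrame c z e) (coordFrame c z f)) =
      -fun z ↦ S.val z (coordFrame c z f) (coordFrame c z e) := funext fun z ↦ S.val_swap z _ _
  rw [hswap, mvfderiv_neg]
  rfl

/-- The coordinate vector fields commute, so this is `dω = 0` evaluated on them. -/
theorem coordDeriv_cyclic [T2Space M] (hy : y ∈ (chartAt E c).source) (u e f : E) :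
    coordDeriv c (coordBilin c S.val) y u e f + coordDeriv c (coordBilin c S.val) y e f u +
      coordDeriv c (coordBilin c S.val) y f u e = 0 := by
  have : CompleteSpace E := FiniteDimensional.complete ℝ E
  choose s hs hse using fun e ↦ exists_contMDiff_eventuallyEq
    ((chartAt E c).open_source.mem_nhds hy) (contMDiffOn_coordFrame (E := E) e)
  have hderiv (u e f : E) : coordDeriv c (coordBilin c S.val) y u e f =
      d% (fun z ↦ S.val z (s e z) (s f z)) y (s u y) := by
    rw [coordDeriv_coordBilin_apply (S.smoothBilinOn _) hy, (hse u).self_of_nhds]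
    refine DFunLike.congr_fun (mvfderiv_congr_of_eventuallyEq ?_) _
    filter_upwards [hse e, hse f] with z he hf
    rw [he, hf]
  have hbracket (e f : E) : VectorField.mlieBracket 𝓘(ℝ, E) (s e) (s f) y = 0 :=
    (Filter.EventuallyEq.mlieBracket_vectorField_eq (hse e) (hse f)).trans
      (mlieBracket_coordFrame hy e f)
  have hclosed := S.closed _ _ _ (hs u) (hs e) (hs f) y
  simp only [← hderiv, hbracket, map_zero, zero_apply, sub_zero, add_zero] at hclosed
  rw [S.coordDeriv_swap hy e f u]
  linarith

/-- Christoffel symbols in the chart at `c` of a torsion-free connection with `∇ω = 0`: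
`ω(Γ(e, u), f) = (u ω(e, f) + e ω(u, f)) / 3`. -/
def christoffel (c y : M) : E →L[ℝ] E →L[ℝ] E :=
  symmetrizeComp (coordBilin c S.val y).inverse (coordDeriv c (coordBilin c S.val) y)

omit [FiniteDimensional ℝ E] in
theorem christoffel_symm (e f : E) : S.christoffel c y e f = S.christoffel c y f e := by
  rw [christoffel, symmetrizeComp_apply, symmetrizeComp_apply, add_comm]

theorem contMDiffOn_christoffel : CMDiff[(chartAt E c).source] ∞ (S.christoffel c) :=
  contMDiffOn_symmetrizeComp
    (contMDiffOn_inverse_coordBilin (S.smoothBilinOn _) fun y _ ↦ S.nondegenerate y)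
    (contMDiffOn_coordDeriv (smoothBilinOn_iff_coordBilin.1 (S.smoothBilinOn _)))

theorem coordBilin_christoffel (hy : y ∈ (chartAt E c).source) (e u f : E) :
    coordBilin c S.val y (S.christoffel c y e u) f =
      (1 / 3 : ℝ) * (coordDeriv c (coordBilin c S.val) y e u f +
        coordDeriv c (coordBilin c S.val) y u e f) := by
  rw [christoffel, symmetrizeComp_apply,
    (isInvertible_coordBilin hy (S.nondegenerate y)).self_apply_inverse]
  rfl

theorem coordDeriv_eq_christoffel [T2Space M] (hy : y ∈ (chartAt E c).source) (u e f : E) :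
    coordDeriv c (coordBilin c S.val) y u e f =
      coordBilin c S.val y (S.christoffel c y e u) f +
        coordBilin c S.val y e (S.christoffel c y f u) := by
  have hswap : coordBilin c S.val y e (S.christoffel c y f u) =
      -coordBilin c S.val y (S.christoffel c y f u) e := S.val_swap y _ _
  rw [hswap, S.coordBilin_christoffel hy, S.coordBilin_christoffel hy]
  linarith [S.coordDeriv_cyclic hy u e f, S.coordDeriv_swap hy u f e, S.coordDeriv_swap hy e u f,
    S.coordDeriv_swap hy f u e]

theorem exists_isParallelAt [T2Space M] [SigmaCompactSpace M] :
    ∃ D : TorsionFreeConnection E M, ∀ x, IsParallelAt D.conn S.val x := by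
  obtain ⟨ρ, hρ⟩ := SmoothPartitionOfUnity.exists_isSubordinate_chartAt_source 𝓘(ℝ, E) M
  have hcov (c : M) := isCovariantDerivativeOn_chartConnection (c := c) (Γ := S.christoffel c)
  refine ⟨⟨gluedConnection hρ hcov, ?_, ?_⟩, fun x ↦ ?_⟩
  · exact contMDiffCovariantDerivative_gluedConnection hρ (fun c ↦ (chartAt E c).open_source)
      fun c σ hσ ↦ smoothEndoOn_chartConnection S.contMDiffOn_christoffel hσ
  · rw [CovariantDerivative.torsion_eq_zero_iff]
    exact fun {X Y x} hX hY ↦ (isTorsionFreeAt_gluedConnection hρ fun c hx ↦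
      isTorsionFreeAt_chartConnection hx S.christoffel_symm).sub_eq_mlieBracket hX hY
  · exact isParallelAt_gluedConnection hρ (hcov := hcov) fun c hx ↦
      isParallelAt_chartConnection (S.smoothBilinOn _) hx (S.coordDeriv_eq_christoffel hx)

end SymplecticStructure

end

section

/-! ## Existence of Riemannian metrics -/

/-- The symmetric positive definite bilinear forms on a topological vector space. -/
def posDefForms (V : Type*) [AddCommGroup V] [Module ℝ V] [TopologicalSpace V] :
    Set (V →L[ℝ] V →L[ℝ] ℝ) :=
  {B | (∀ u v, B u v = B v u) ∧ ∀ u, u ≠ 0 → 0 < B u u}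

theorem convex_posDefForms (V : Type*) [AddCommGroup V] [Module ℝ V] [TopologicalSpace V] :
    Convex ℝ (posDefForms V) := by
  rintro B ⟨hBsymm, hBpos⟩ C ⟨hCsymm, hCpos⟩ s t hs ht hst
  refine ⟨fun u v ↦ by simp [hBsymm u v, hCsymm u v], fun u hu ↦ ?_⟩
  exact convex_Ioi (0 : ℝ) (hBpos u hu) (hCpos u hu) hs ht hst

theorem nonempty_posDefForms (V : Type*) [AddCommGroup V] [Module ℝ V] [TopologicalSpace V]
    [IsTopologicalAddGroup V] [ContinuousSMul ℝ V] [T2Space V] [FiniteDimensional ℝ V] :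
    (posDefForms V).Nonempty := by
  let L : V ≃L[ℝ] EuclideanSpace ℝ (Fin (Module.finrank ℝ V)) := toEuclidean
  let L' : V →L[ℝ] EuclideanSpace ℝ (Fin (Module.finrank ℝ V)) := L
  exact ⟨ContinuousLinearMap.precomp ℝ L' ∘L innerSL ℝ ∘L L',
    fun u v ↦ real_inner_comm (L v) (L u),
    fun u hu ↦ real_inner_self_pos.2 (L.map_eq_zero_iff.not.2 hu)⟩

variable {E : Type*} [NormedAddCommGroup E] [NormedSpace ℝ E] [FiniteDimensional ℝ E]
  {M : Type*} [TopologicalSpace M] [ChartedSpace E M] [IsManifold 𝓘(ℝ, E) ∞ M]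

theorem exists_smoothBilinOn_chart_source_mem_posDefForms (c : M) :
    ∃ q : BilinField E M, SmoothBilinOn q (chartAt E c).source ∧
      ∀ y ∈ (chartAt E c).source, q y ∈ posDefForms (TangentSpace 𝓘(ℝ, E) y) := by
  obtain ⟨B, hsymm, hpos⟩ := nonempty_posDefForms E
  refine ⟨fun y ↦ ContinuousLinearMap.precomp ℝ (coordMap c y) ∘L B ∘L coordMap c y, ?_,
    fun y hy ↦ ⟨fun u v ↦ hsymm _ _, fun u hu ↦ hpos _ fun h ↦ hu ?_⟩⟩
  · refine smoothBilinOn_iff_coordBilin.2 (contMDiffOn_const (c := B) |>.congr fun y hy ↦ ?_)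
    ext e f
    simp [coordBilin_apply, coordMap_coordFrame hy]
  · have hcoord : coordMap c y u = 0 := h
    rw [← coordFrame_coordMap hy u, hcoord, map_zero]

set_option maxHeartbeats 400000 in
-- Instances on iterated spaces of continuous linear maps between tangent spaces are expensive.
set_option synthInstance.maxHeartbeats 400000 in
theorem nonempty_pseudoRiemannianMetric [T2Space M] [SigmaCompactSpace M] :
    Nonempty (PseudoRiemannianMetric E M) := by
  obtain ⟨g, hg⟩ := exists_contMDiffSection_forall_mem_convex_of_local 𝓘(ℝ, E) (n := ⊤)
    (F_fiber := E →L[ℝ] E →L[ℝ] ℝ)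
    (fun x : M ↦ TangentSpace 𝓘(ℝ, E) x →L[ℝ] TangentSpace 𝓘(ℝ, E) x →L[ℝ] ℝ)
    (fun x ↦ posDefForms (TangentSpace 𝓘(ℝ, E) x))
    (fun x ↦ convex_posDefForms (TangentSpace 𝓘(ℝ, E) x))
    fun c ↦ ⟨(chartAt E c).source, chart_source_mem_nhds E c,
      exists_smoothBilinOn_chart_source_mem_posDefForms c⟩
  refine ⟨⟨g, fun x ↦ (hg x).1, fun x u hu ↦ ?_, g.contMDiff⟩⟩
  by_contra h
  exact ((hg x).2 u h).ne' (hu u)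

/-! ## The gauge transformation of a symplectic form -/

namespace PseudoRiemannianMetric

variable (g : PseudoRiemannianMetric E M) (S : SymplecticStructure E M)

/-- The gauge transformation `φ` with `g(φ u, v) = S(u, v)`. -/
def gaugeOfSymplectic : InfinitesimalGauge E M where
  val x := LinearMap.toContinuousLinearMap ((g.sharp x).toLinearMap.comp
    ((ContinuousLinearMap.coeLM ℝ).comp (S.val x : _ →ₗ[ℝ] _)))
  contMDiff := by
    refine contMDiff_of_contMDiffOn_chart_source fun c ↦ smoothEndoOn_iff_coordEndo.2 ?_
    have hinv := contMDiffOn_inverse_coordBilin (c := c) g.contMDiff.contMDiffOn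
      fun y _ ↦ g.nondegenerate y
    refine (hinv.clm_comp (smoothBilinOn_iff_coordBilin.1 (S.smoothBilinOn _))).congr
      fun y hy ↦ ?_
    ext e
    have hg := isInvertible_coordBilin hy (g.nondegenerate y)
    refine hg.injective (Eq.trans ?_ (hg.self_apply_inverse _).symm)
    ext f
    rw [coordBilin_apply, coordFrame_coordEndo hy]
    exact g.val_sharp y _ _

theorem val_gaugeOfSymplectic (x : M) (u v : TangentSpace 𝓘(ℝ, E) x) :
    g.val x ((g.gaugeOfSymplectic S).val x u) v = S.val x u v :=
  g.val_sharp x _ _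

theorem gaugeOfSymplectic_mem_gaugeSolutions {D : TorsionFreeConnection E M}
    (hD : ∀ x, IsParallelAt D.conn S.val x) : g.gaugeOfSymplectic S ∈ g.gaugeSolutions D := by
  intro _ Y _ hY x
  have hφY : MDiffAt (T% fun y ↦ (g.gaugeOfSymplectic S).val y (Y y)) x :=
    ((g.gaugeOfSymplectic S).contMDiff.clm_bundle_apply hY).mdifferentiableAt (by simp)
  refine g.ext_val fun Z hZ ↦ ?_
  rw [g.dualConnection_apply _ hφY hZ]
  simp only [val_gaugeOfSymplectic]
  rw [bilinDerivAt_eq_zero_iff.1 (hD x (hY.mdifferentiableAt (by simp)) hZ _), add_sub_cancel_right]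

theorem skewPart_gaugeOfSymplectic (x : M) :
    g.skewPart (g.gaugeOfSymplectic S) x = (g.gaugeOfSymplectic S).val x := by
  ext u
  refine sub_eq_zero.1 (g.nondegenerate x _ fun v ↦ ?_)
  rw [map_sub, sub_apply, g.val_skewPart, g.symm x u, ContinuousLinearMap.coe_coe,
    val_gaugeOfSymplectic, val_gaugeOfSymplectic, S.val_swap x v u]
  ring

theorem corankAt_gaugeOfSymplectic (x : M) : g.corankAt (g.gaugeOfSymplectic S) x = 0 := by
  have hinj : Function.Injective (g.skewPart (g.gaugeOfSymplectic S) x) := by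
    refine (injective_iff_map_eq_zero _).2 fun u hu ↦ S.nondegenerate x u fun v ↦ ?_
    rw [skewPart_gaugeOfSymplectic, ContinuousLinearMap.coe_coe] at hu
    rw [← g.val_gaugeOfSymplectic S, hu, map_zero, zero_apply]
  rw [corankAt, LinearMap.finrank_range_of_inj hinj]
  exact Nat.sub_self _

end PseudoRiemannianMetric

theorem symplecticGap_eq_zero [T2Space M] [SigmaCompactSpace M] [Nonempty M]
    (S : SymplecticStructure E M) : symplecticGap E M = 0 := by
  obtain ⟨D, hD⟩ := S.exists_isParallelAt
  obtain ⟨g⟩ := nonempty_pseudoRiemannianMetric (E := E) (M := M)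
  obtain ⟨x⟩ := ‹Nonempty M›
  simp only [symplecticGap, PseudoRiemannianMetric.gap, ENat.iInf_eq_zero, Nat.cast_eq_zero]
  exact ⟨D, g, g.gaugeOfSymplectic S, g.gaugeOfSymplectic_mem_gaugeSolutions S hD, x,
    g.corankAt_gaugeOfSymplectic S x⟩

end

end

theorem mainTheorem8 (E : Type*) [NormedAddCommGroup E] [NormedSpace ℝ E] [FiniteDimensional ℝ E]
    (M : Type*) [TopologicalSpace M] [T2Space M] [ParacompactSpace M] [ConnectedSpace M]
    [ChartedSpace E M] [IsManifold 𝓘(ℝ, E) ∞ M] :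
    symplecticGap E M = 0 ↔ Nonempty (SymplecticStructure E M) := by
  have : LocallyCompactSpace M := ChartedSpace.locallyCompactSpace E M
  have : SigmaCompactSpace M := sigmaCompactSpace_of_connected_paracompact M
  exact ⟨nonempty_symplecticStructure_of_symplecticGap_eq_zero,
    fun ⟨S⟩ ↦ symplecticGap_eq_zero S⟩
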